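/- All graphs are finite and simple. For a graph $G$ and $T\subseteq V(G)$ let $G\setminus T$ be the induced subgraph on $V(G)\setminus T$ and $c_G(T)$ its number of connected components. The set $T$ is a cutset of $G$ if $c_G(T\setminus\{v\})<c_G(T)$ for every $v\in T$; a vertex $v$ is a cutpoint if $\{v\}$ is a cutset. A block of $G$ is a connected induced subgraph that has no cutpoint and is maximal with this property. Fix a field $\mathbb K$; the binomial edge ideal of $G$ is $$J_G=(x_iy_j-x_jy_i \mid \{i,j\}\in E(G))\subseteq S=\mathbb K[x_i,y_i \mid i\in V(G)].$$ $G$ is accessible if $J_G$ is unmixed (all associated primes of $S/J_G$ have the same height) and every non-empty cutset $T$ of $G$ contains some $t$ such that $T\setminus\{t\}$ is again a cutset of $G$. Let $G$ be a connected graph, $B$ a block of $G$, and $W$ the set of cutpoints of $G$ lying in $V(B)$. The block with whiskers $\overline B$ is the graph with $V(\overline B)=V(B)\cup\{f_w \mid w\in W\}$, where the $f_w$ are distinct new vertices, and $E(\overline B)=E(B)\cup\{\{w,f_w\}\mid w\in W\}$. For $w\in W$, let $V(G_w)$ be the set of vertices of $G$ that can be joined to $w$ by a walk meeting $V(B)$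 only in $w$. **Proposition.** Let $G$ be a connected accessible graph and $B$ a block of $G$. Then $\overline B$ is accessible. Moreover, there is a (unique) surjection $\pi:V(G)\to V(\overline B)$ such that, for every $v\in V(G)$, $\pi(v)=b\in V(B)$ if and only if $v=b$, and $\pi(v)=f_w$ if and only if $v\in V(G_w)\setminus\{w\}$. Every cutset $T$ of $\overline B$ is contained in $V(B)$, and $\pi$ maps $V(G)\setminus T$ into $V(\overline B)\setminus T$ and induces a bijection from the set of connected components of $G\setminus T$ to the set of connected components of $\overline B\setminus T$. -/

import Mathlib

namespace AccessibleGraph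

universe u v

/-- `c_G(T)`: the number of connected components of `G ∖ T`. -/
noncomputable def numComponents {V : Type u} (G : SimpleGraph V) (T : Set V) : ℕ :=
  Nat.card (G.induce Tᶜ).ConnectedComponent

/-- `T` is a cutset of `G`: `c_G(T ∖ {v}) < c_G(T)` for every `v ∈ T`. The empty set is a cutset. -/
def IsCutset {V : Type u} (G : SimpleGraph V) (T : Set V) : Prop :=
  ∀ v ∈ T, numComponents G (T \ {v}) < numComponents G T

/-- `v` is a cutpoint of `G`: the set `{v}` is a cutset. -/
def IsCutpoint {V : Type u} (G : SimpleGraph V) (v : V) : Prop :=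
  IsCutset G {v}

/-- `B` is the vertex set of a block of `G`: the induced subgraph on `B` is connected, has no
cutpoint of its own, and is maximal with these properties. -/
def IsBlock {V : Type u} (G : SimpleGraph V) (B : Set V) : Prop :=
  Maximal (fun s : Set V => (G.induce s).Connected ∧ ∀ v : s, ¬ IsCutpoint (G.induce s) v) B

/-- The binomial edge ideal `J_G`, generated by `x_i y_j - x_j y_i` for the edges `{i, j}` of `G`,
in the polynomial ring with the variables `x_i = X (Sum.inl i)` and `y_i = X (Sum.inr i)`. -/
noncomputable def binomialEdgeIdeal (K : Type v) [Field K] {V : Type u} (G : SimpleGraph V) :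
    Ideal (MvPolynomial (V ⊕ V) K) :=
  Ideal.span {f | ∃ i j : V, G.Adj i j ∧
    f = MvPolynomial.X (Sum.inl i) * MvPolynomial.X (Sum.inr j)
      - MvPolynomial.X (Sum.inl j) * MvPolynomial.X (Sum.inr i)}

/-- An ideal `I` of `R` is unmixed if all associated primes of `R ⧸ I` have the same height. -/
def IsUnmixed {R : Type u} [CommRing R] (I : Ideal R) : Prop :=
  ∀ P ∈ associatedPrimes R (R ⧸ I), ∀ Q ∈ associatedPrimes R (R ⧸ I), P.height = Q.height

/-- `G` is accessible (over the field `K`): `J_G` is unmixed and the cutsets of `G` form an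
accessible set system. -/
def IsAccessible (K : Type v) [Field K] {V : Type u} (G : SimpleGraph V) : Prop :=
  IsUnmixed (binomialEdgeIdeal K G) ∧
    ∀ T : Set V, IsCutset G T → T.Nonempty → ∃ t ∈ T, IsCutset G (T \ {t})

/-- The set `W` of the cutpoints of `G` that are vertices of `B`. -/
def cutpointsIn {V : Type u} (G : SimpleGraph V) (B : Set V) : Set V :=
  {w | w ∈ B ∧ IsCutpoint G w}

/-- The vertices of the block with whiskers: those of `B` (as `Sum.inl b`), and for each `w ∈ W`
one new vertex `f_w` (as `Sum.inr w`). -/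
abbrev WhiskerVertex {V : Type u} (G : SimpleGraph V) (B : Set V) : Type u :=
  B ⊕ cutpointsIn G B

/-- Adjacency in the block with whiskers: the edges of `B`, and the edges `{w, f_w}`, `w ∈ W`. -/
def whiskerAdj {V : Type u} (G : SimpleGraph V) (B : Set V) :
    WhiskerVertex G B → WhiskerVertex G B → Prop
  | Sum.inl a, Sum.inl b => G.Adj a b
  | Sum.inl a, Sum.inr w => (a : V) = w
  | Sum.inr w, Sum.inl a => (a : V) = w
  | Sum.inr _, Sum.inr _ => False

/-- The block with whiskers obtained from the block `B` of `G`. -/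
def blockWithWhiskers {V : Type u} (G : SimpleGraph V) (B : Set V) :
    SimpleGraph (WhiskerVertex G B) where
  Adj := whiskerAdj G B
  symm := ⟨by
    rintro (a | a) (b | b) h
    · exact SimpleGraph.Adj.symm h
    · exact h
    · exact h
    · exact h⟩
  loopless := ⟨by
    rintro (a | a) h
    · exact G.loopless.irrefl _ h
    · exact h⟩

/-- The vertex set of the branch `G_w` of `G` hanging at the vertex `w` of `B`: the vertices that
can be joined to `w` by a walk which meets `B` only in `w`. In particular it contains `w`. -/
def branch {V : Type u} (G : SimpleGraph V) (B : Set V) (w : V) : Set V :=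
  {v | ∃ p : G.Walk w v, ∀ x ∈ p.support, x ∈ B → x = w}

/-- `π` is the canonical projection of the vertices of `G` onto those of the block with whiskers:
it is onto, it fixes the vertices of `B`, and it sends exactly the vertices of `G_w` other than `w`
to `f_w`. (These conditions determine `π`.) -/
def IsWhiskerProjection {V : Type u} (G : SimpleGraph V) (B : Set V)
    (π : V → WhiskerVertex G B) : Prop :=
  Function.Surjective π ∧
    (∀ (v : V) (b : B), π v = Sum.inl b ↔ v = b) ∧
    ∀ (v : V) (w : cutpointsIn G B), π v = Sum.inr w ↔ v ∈ branch G B w \ {(w : V)}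

end AccessibleGraph

/-!
The theorem combines the known description of the associated primes of a binomial edge ideal with
the structure of a connected graph around one of its blocks.

**Unmixedness.** For a set `T` of vertices let `P_T(G)` be the ideal generated by the variables of
the vertices of `T` and by the binomials `x_i y_j - x_j y_i` with `i`, `j` in one component of
`G ∖ T`. It is the kernel of a monomial map (`toricPrime_le`), hence prime, and its height is
`|V| + |T| - c_G(T)` (`height_cutPrime`): Krull's height theorem bounds it from above, and merging
components and killing variables one at a time gives a long enough chain of primes. For a vertex `v`
outside `T`, the ideal `(x_t, y_t : t ∈ T) + J_G` contains the intersection of the same ideal for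
the graph with the neighbourhood of `v` completed and of the ideal for `T ∪ {v}`
(`mem_cutIdeal_of_mem_completeAt`). Repeating this until adjacency outside `T` is transitive shows
that `J_G` is the intersection of the `P_T(G)`. So the associated primes of `S / J_G` are the
minimal ones among the `P_T(G)`, and these belong to the cutsets `T`. For a connected graph,
`J_G` is therefore unmixed if and only if `c_G(T) = |T| + 1` for every cutset `T` (`isUnmixed_iff`).

**Blocks.** A path between two vertices of a block `B` stays in `B`
(`IsBlock.support_subset`), so each vertex outside `B` hangs at a unique vertex of `B`, which is a
cutpoint, and this defines `π`. Unmixedness gives `c_G({w}) = 2` for each cutpoint `w`, so the part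
of the graph hanging at `w` is connected without `w` (`IsBlock.reachable_avoid`). Hence `π` has
connected fibres, and for `T ⊆ B` it induces a bijection between the components of `G ∖ T` and those
of the block with whiskers minus `T` (`IsWhiskerProjection.exists_equiv`). In particular the cutsets
of the block with whiskers are the cutsets of `G` contained in `B`, with the same numbers of
components, and both parts of accessibility carry over.
-/

namespace AccessibleGraph

universe u

/-! ### Toric primes attached to a partition of the vertices -/

section Toric

open MvPolynomial

variable (K : Type*) [Field K] {V C C' : Type*}

/-- The binomial `x_i y_j - x_j y_i`. -/
noncomputable def edgeBinomial (i j : V) : MvPolynomial (V ⊕ V) K :=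
  X (Sum.inl i) * X (Sum.inr j) - X (Sum.inl j) * X (Sum.inr i)

open Classical in
/-- The monomial parametrization attached to a partition of the vertices, given as a map `c` to the
set `C` of classes: `x_i ↦ s_i u_{c(i)}` and `y_i ↦ s_i v_{c(i)}`, except that `x_i` is sent to `0`
if the class of `i` is in `α`, and `y_i` is sent to `0` if it is in `β`. -/
noncomputable def param (c : V → C) (α β : Set C) :
    MvPolynomial (V ⊕ V) K →ₐ[K] MvPolynomial (V ⊕ (C ⊕ C)) K :=
  aeval (Sum.elim
    (fun i => if c i ∈ α then 0 else X (Sum.inl i) * X (Sum.inr (Sum.inl (c i))))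
    (fun i => if c i ∈ β then 0 else X (Sum.inl i) * X (Sum.inr (Sum.inr (c i)))))

/-- The prime ideal of all polynomials that vanish under the parametrization. For `α = β` it is
generated by the variables of the vertices in classes of `α` and by the `x_i y_j - x_j y_i` with
`i` and `j` in the same class. -/
noncomputable def toricPrime (c : V → C) (α β : Set C) : Ideal (MvPolynomial (V ⊕ V) K) :=
  RingHom.ker (param K c α β)

instance (c : V → C) (α β : Set C) : (toricPrime K c α β).IsPrime :=
  RingHom.ker_isPrime _

variable {K}

theorem mem_toricPrime {c : V → C} {α β : Set C} {f : MvPolynomial (V ⊕ V) K} :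
    f ∈ toricPrime K c α β ↔ param K c α β f = 0 := RingHom.mem_ker

/-- Coarsening the partition and killing more classes enlarges the prime. -/
theorem toricPrime_mono {c : V → C} {c' : V → C'} {α β : Set C} {α' β' : Set C'} (d : C → C')
    (hd : ∀ i, d (c i) = c' i) (hα : α ⊆ d ⁻¹' α') (hβ : β ⊆ d ⁻¹' β') :
    toricPrime K c α β ≤ toricPrime K c' α' β' := by
  classical
  intro f hf
  rw [mem_toricPrime] at hf ⊢
  let ψ : MvPolynomial (V ⊕ (C ⊕ C)) K →ₐ[K] MvPolynomial (V ⊕ (C' ⊕ C')) K :=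
    aeval (Sum.elim (fun i => X (Sum.inl i)) (Sum.elim
      (fun k => if d k ∈ α' then 0 else X (Sum.inr (Sum.inl (d k))))
      (fun k => if d k ∈ β' then 0 else X (Sum.inr (Sum.inr (d k))))))
  have h : param K c' α' β' = ψ.comp (param K c α β) := by
    refine MvPolynomial.algHom_ext fun k => ?_
    rcases k with i | i
    · by_cases h1 : c i ∈ α
      · have : c' i ∈ α' := hd i ▸ hα h1
        simp [param, h1, this]
      · by_cases h2 : c' i ∈ α' <;> simp [param, ψ, h1, hd, h2]
    · by_cases h1 : c i ∈ β
      · have : c' i ∈ β' := hd i ▸ hβ h1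
        simp [param, h1, this]
      · by_cases h2 : c' i ∈ β' <;> simp [param, ψ, h1, hd, h2]
  rw [h, AlgHom.comp_apply, hf, map_zero]

theorem X_inl_mem_toricPrime {c : V → C} {α β : Set C} {i : V} :
    (X (Sum.inl i) : MvPolynomial (V ⊕ V) K) ∈ toricPrime K c α β ↔ c i ∈ α := by
  rw [mem_toricPrime]
  by_cases h : c i ∈ α <;> simp [param, h, X_ne_zero]

theorem X_inr_mem_toricPrime {c : V → C} {α β : Set C} {i : V} :
    (X (Sum.inr i) : MvPolynomial (V ⊕ V) K) ∈ toricPrime K c α β ↔ c i ∈ β := by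
  rw [mem_toricPrime]
  by_cases h : c i ∈ β <;> simp [param, h, X_ne_zero]

theorem edgeBinomial_mem_toricPrime {c : V → C} {α : Set C} {i j : V} :
    edgeBinomial K i j ∈ toricPrime K c α α ↔ c i = c j ∨ c i ∈ α ∨ c j ∈ α := by
  classical
  constructor
  · intro h
    by_contra! hn
    obtain ⟨h0, h1, h2⟩ := hn
    rw [mem_toricPrime] at h
    -- specialize to `s = 1`, `u` the indicator of the class of `i`, `v` that of the class of `j`
    have h3 := congrArg (aeval (R := K) (Sum.elim (fun _ : V => (1 : K)) (Sum.elim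
      (fun k => if k = c i then (1 : K) else 0) (fun k => if k = c j then (1 : K) else 0)))) h
    simp [param, edgeBinomial, h1, h2, h0] at h3
  · intro h
    rw [mem_toricPrime]
    rcases h with h | h | h
    · by_cases h1 : c i ∈ α
      · simp [param, edgeBinomial, h, h ▸ h1]
      · simp only [param, edgeBinomial, map_sub, map_mul, aeval_X, Sum.elim_inl, Sum.elim_inr, ← h,
          h1, if_false]
        ring
    · simp [param, edgeBinomial, h]
    · simp [param, edgeBinomial, h]

/-- Splitting the classes one vertex at a time gives a chain of primes. -/
theorem card_le_height_toricPrime_empty [Finite V] (m : ℕ) :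
    ∀ {C : Type u} [Finite C] (c : V → C), Function.Surjective c → Nat.card V ≤ Nat.card C + m →
      (Nat.card V : ℕ∞) ≤ (toricPrime K c ∅ ∅).height + Nat.card C := by
  classical
  induction m with
  | zero =>
    intro C _ c _ hm
    exact le_add_left (by exact_mod_cast hm)
  | succ m ih =>
    intro C _ c hc hm
    by_cases hinj : Function.Injective c
    · exact le_add_left (by exact_mod_cast Nat.card_le_card_of_injective c hinj)
    · simp only [Function.Injective, not_forall] at hinj
      obtain ⟨i, j, hij, hne⟩ := hinj
      let c' : V → Option C := Function.update (fun k => some (c k)) i none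
      have hcj : ∀ k, k ≠ i → c' k = some (c k) := fun k hk => by simp [c', hk]
      have hci : c' i = none := by simp [c']
      have hc' : Function.Surjective c' := by
        rintro (_ | a)
        · exact ⟨i, hci⟩
        · obtain ⟨k, rfl⟩ := hc a
          by_cases hk : k = i
          · exact ⟨j, by rw [hcj j (Ne.symm hne), hk, hij]⟩
          · exact ⟨k, hcj k hk⟩
      have hcard : Nat.card (Option C) = Nat.card C + 1 := Finite.card_option
      have h1 := ih c' hc' (by omega)
      have hlt : toricPrime K c' ∅ ∅ < toricPrime K c ∅ ∅ := by
        refine lt_of_le_of_ne (toricPrime_mono (fun o => o.elim (c i) id) ?_ (by simp) (by simp)) ?_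
        · intro k
          by_cases hk : k = i
          · subst hk; rw [hci]; rfl
          · rw [hcj k hk]; rfl
        · intro heq
          have h2 : edgeBinomial K i j ∈ toricPrime K c ∅ ∅ :=
            edgeBinomial_mem_toricPrime.2 (Or.inl hij)
          rw [← heq, edgeBinomial_mem_toricPrime, hci, hcj j (Ne.symm hne)] at h2
          simp at h2
      have h2 := Ideal.height_add_one_le_of_lt_of_isPrime hlt
      rw [hcard] at h1
      calc (Nat.card V : ℕ∞) ≤ (toricPrime K c' ∅ ∅).height + ((Nat.card C + 1 : ℕ) : ℕ∞) := h1
        _ = (toricPrime K c' ∅ ∅).height + 1 + Nat.card C := by push_cast; ring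
        _ ≤ _ := by gcongr

/-- A lower bound for the height of a toric prime: kill the variables of `α` and `β` one class at
a time. -/
theorem card_add_ncard_le_height_toricPrime [Finite V] {C : Type u} [Finite C] {c : V → C}
    (hc : Function.Surjective c) (α β : Set C) :
    ((Nat.card V + α.ncard + β.ncard : ℕ) : ℕ∞) ≤ (toricPrime K c α β).height + Nat.card C := by
  classical
  have hα : ∀ α : Set C, ((Nat.card V + α.ncard : ℕ) : ℕ∞) ≤
      (toricPrime K c α ∅).height + Nat.card C := by
    intro α
    induction α, α.toFinite using Set.Finite.induction_on with
    | empty =>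
      simpa using card_le_height_toricPrime_empty (K := K) _ c hc
        (Nat.le_add_left (Nat.card V) (Nat.card C))
    | @insert a s ha hs ih =>
      have hlt : toricPrime K c s ∅ < toricPrime K c (insert a s) ∅ := by
        refine lt_of_le_of_ne (toricPrime_mono id (fun _ => rfl) (by simp) (by simp)) fun heq => ?_
        obtain ⟨i, rfl⟩ := hc a
        have : (X (Sum.inl i) : MvPolynomial (V ⊕ V) K) ∈ toricPrime K c (insert (c i) s) ∅ :=
          X_inl_mem_toricPrime.2 (by simp)
        rw [← heq, X_inl_mem_toricPrime] at this
        exact ha this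
      rw [Set.ncard_insert_of_notMem ha hs]
      calc ((Nat.card V + (s.ncard + 1) : ℕ) : ℕ∞) = ((Nat.card V + s.ncard : ℕ) : ℕ∞) + 1 := by
            push_cast; ring
        _ ≤ (toricPrime K c s ∅).height + Nat.card C + 1 := by gcongr
        _ = (toricPrime K c s ∅).height + 1 + Nat.card C := by ring
        _ ≤ _ := by gcongr; exact Ideal.height_add_one_le_of_lt_of_isPrime hlt
  induction β, β.toFinite using Set.Finite.induction_on with
  | empty => simpa using hα α
  | @insert a s ha hs ih =>
    have hlt : toricPrime K c α s < toricPrime K c α (insert a s) := by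
      refine lt_of_le_of_ne (toricPrime_mono id (fun _ => rfl) (by simp) (by simp)) fun heq => ?_
      obtain ⟨i, rfl⟩ := hc a
      have : (X (Sum.inr i) : MvPolynomial (V ⊕ V) K) ∈ toricPrime K c α (insert (c i) s) :=
        X_inr_mem_toricPrime.2 (by simp)
      rw [← heq, X_inr_mem_toricPrime] at this
      exact ha this
    rw [Set.ncard_insert_of_notMem ha hs]
    calc ((Nat.card V + α.ncard + (s.ncard + 1) : ℕ) : ℕ∞)
        = ((Nat.card V + α.ncard + s.ncard : ℕ) : ℕ∞) + 1 := by push_cast; ring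
      _ ≤ (toricPrime K c α s).height + Nat.card C + 1 := by gcongr
      _ = (toricPrime K c α s).height + 1 + Nat.card C := by ring
      _ ≤ _ := by gcongr; exact Ideal.height_add_one_le_of_lt_of_isPrime hlt

end Toric

/-! ### Generators of the toric primes -/

section Toric

open MvPolynomial

variable {K : Type*} [Field K] {V C : Type*}

/-- Two monomials with the same total exponent of `x_i y_i` for all `i`, and the same total
exponent of the variables `y_i` over each class, are congruent modulo the binomials
`x_i y_j - x_j y_i` with `i` and `j` in the same class: exchange factors `x_i y_j` for `x_j y_i`
until the exponents agree. -/
theorem monomial_sub_monomial_mem [Fintype V] [DecidableEq C] {c : V → C}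
    {I : Ideal (MvPolynomial (V ⊕ V) K)} (hI : ∀ i j, c i = c j → edgeBinomial K i j ∈ I) (d : ℕ) :
    ∀ m m' : V ⊕ V →₀ ℕ,
      (∀ i, m (Sum.inl i) + m (Sum.inr i) = m' (Sum.inl i) + m' (Sum.inr i)) →
      (∀ k, ∑ i with c i = k, m (Sum.inr i) = ∑ i with c i = k, m' (Sum.inr i)) →
      ∑ i, (m (Sum.inr i) - m' (Sum.inr i)) ≤ d →
      monomial m (1 : K) - monomial m' 1 ∈ I := by
  classical
  induction d with
  | zero =>
    intro m m' h1 h2 h3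
    have hle : ∀ i, m (Sum.inr i) ≤ m' (Sum.inr i) := by
      intro i
      have h4 := Finset.single_le_sum (f := fun i => m (Sum.inr i) - m' (Sum.inr i))
        (fun _ _ => Nat.zero_le _) (Finset.mem_univ i)
      omega
    have heq : ∀ i, m (Sum.inr i) = m' (Sum.inr i) := fun i =>
      (Finset.sum_eq_sum_iff_of_le fun j _ => hle j).1 (h2 (c i)) i (by simp)
    have : m = m' := by
      ext (i | i)
      · have := h1 i
        have := heq i
        omega
      · exact heq i
    simp [this]
  | succ d ih =>
    intro m m' h1 h2 h3
    by_cases hex : ∃ i, m' (Sum.inr i) < m (Sum.inr i)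
    swap
    · refine ih m m' h1 h2 ?_
      push Not at hex
      simp [Nat.sub_eq_zero_of_le (hex _)]
    obtain ⟨i, hi⟩ := hex
    obtain ⟨j, hj, hlt⟩ : ∃ j, c j = c i ∧ m (Sum.inr j) < m' (Sum.inr j) := by
      by_contra! hno
      exact (Finset.sum_lt_sum (s := Finset.univ.filter fun j => c j = c i)
        (f := fun j => m' (Sum.inr j)) (g := fun j => m (Sum.inr j))
        (fun j hj => hno j (by simpa using hj)) ⟨i, by simp, hi⟩).ne' (h2 (c i))
    have hij : i ≠ j := by rintro rfl; omega
    have hi1 : 0 < m' (Sum.inl i) := by have := h1 i; omega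
    let r : V ⊕ V →₀ ℕ := m' - (Finsupp.single (Sum.inl i) 1 + Finsupp.single (Sum.inr j) 1)
    have hr : m' = r + (Finsupp.single (Sum.inl i) 1 + Finsupp.single (Sum.inr j) 1) := by
      refine (tsub_add_cancel_of_le ?_).symm
      rintro (k | k)
      · by_cases hk : i = k
        · subst hk; simpa using Nat.succ_le_of_lt hi1
        · simp [hk]
      · by_cases hk : j = k
        · subst hk; simp; omega
        · simp [hk]
    let m'' : V ⊕ V →₀ ℕ := r + (Finsupp.single (Sum.inl j) 1 + Finsupp.single (Sum.inr i) 1)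
    have hl' : ∀ k, m' (Sum.inl k) = r (Sum.inl k) + if i = k then 1 else 0 := fun k => by
      conv_lhs => rw [hr]
      simp [Finsupp.single_apply]
    have hr' : ∀ k, m' (Sum.inr k) = r (Sum.inr k) + if j = k then 1 else 0 := fun k => by
      conv_lhs => rw [hr]
      simp [Finsupp.single_apply]
    have hl'' : ∀ k, m'' (Sum.inl k) = r (Sum.inl k) + if j = k then 1 else 0 := fun k => by
      simp [m'', Finsupp.single_apply]
    have hr'' : ∀ k, m'' (Sum.inr k) = r (Sum.inr k) + if i = k then 1 else 0 := fun k => by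
      simp [m'', Finsupp.single_apply]
    have hdiff : monomial m'' (1 : K) - monomial m' 1 ∈ I := by
      have : monomial m'' (1 : K) - monomial m' 1 = monomial r 1 * edgeBinomial K j i := by
        rw [hr]
        simp only [m'', edgeBinomial, X, mul_sub, monomial_mul, mul_one]
      rw [this]
      exact I.mul_mem_left _ (hI _ _ hj)
    have hmm : monomial m (1 : K) - monomial m'' 1 ∈ I := by
      refine ih m m'' ?_ ?_ ?_
      · intro k
        rw [h1 k, hl', hr', hl'', hr'']
        ring
      · intro k
        rw [h2 k]
        simp only [hr', hr'', Finset.sum_add_distrib]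
        congr 1
        by_cases hk : c i = k <;> simp [Finset.sum_ite_eq, hj, hk]
      · have hlt : ∑ k, (m (Sum.inr k) - m'' (Sum.inr k)) <
            ∑ k, (m (Sum.inr k) - m' (Sum.inr k)) := by
          refine Finset.sum_lt_sum (fun k _ => ?_) ⟨i, Finset.mem_univ _, ?_⟩
          · have e1 := hr' k
            have e2 := hr'' k
            by_cases hk : j = k
            · subst hk
              simp [hij] at e1 e2
              omega
            · simp only [hk, if_false] at e1
              omega
          · have e1 := hr' i
            have e2 := hr'' i
            simp [hij.symm] at e1 e2
            omega
        omega
    simpa using I.add_mem hmm hdiff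

theorem mapDomain_apply_eq_sum {σ τ : Type*} [Fintype σ] [DecidableEq τ] (f : σ → τ) (m : σ →₀ ℕ)
    (a : τ) : Finsupp.mapDomain f m a = ∑ k, if f k = a then m k else 0 := by
  rw [Finsupp.mapDomain, Finsupp.sum_fintype _ _ (by simp), Finsupp.finsetSum_apply]
  simp [Finsupp.single_apply]

/-- The image of a monomial under the parametrization is `0` or a monomial. -/
theorem param_monomial [Finite V] (c : V → C) (α : Set C) (m : V ⊕ V →₀ ℕ) :
    (∃ k ∈ m.support, Sum.elim c c k ∈ α) ∧ param K c α α (monomial m 1) = 0 ∨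
    param K c α α (monomial m 1) =
      monomial (Finsupp.mapDomain (Sum.elim Sum.inl Sum.inl) m +
        Finsupp.mapDomain (Sum.elim (Sum.inr ∘ Sum.inl ∘ c) (Sum.inr ∘ Sum.inr ∘ c)) m) 1 := by
  classical
  by_cases h : ∃ k ∈ m.support, Sum.elim c c k ∈ α
  · refine Or.inl ⟨h, ?_⟩
    obtain ⟨k, hk, hka⟩ := h
    rw [param, aeval_monomial, Finsupp.prod, Finset.prod_eq_zero hk, mul_zero]
    rw [Finsupp.mem_support_iff] at hk
    rcases k with i | i
    · simp only [Sum.elim_inl] at hka ⊢; simp [hka, hk]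
    · simp only [Sum.elim_inr] at hka ⊢; simp [hka, hk]
  · right
    have e : ∀ f : V ⊕ V → V ⊕ (C ⊕ C), monomial (Finsupp.mapDomain f m) (1 : K) =
        m.prod fun k e => X (f k) ^ e := fun f => by
      rw [monomial_eq, C_1, one_mul, Finsupp.prod_mapDomain_index (fun _ => pow_zero _)
        fun _ _ _ => pow_add _ _ _]
    rw [← mul_one (1 : K), ← monomial_mul, e, e, ← Finsupp.prod_mul, mul_one, param, aeval_monomial,
      map_one, one_mul]
    refine Finset.prod_congr rfl fun k hk => ?_
    have hk' : Sum.elim c c k ∉ α := fun h' => h ⟨k, hk, h'⟩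
    rcases k with i | i
    · simp only [Sum.elim_inl] at hk' ⊢; simp [hk', mul_pow]
    · simp only [Sum.elim_inr] at hk' ⊢; simp [hk', mul_pow]

/-- The toric prime is generated by the variables of the killed classes and the binomials of the
pairs in a common class. -/
theorem toricPrime_le [Finite V] {c : V → C} {α : Set C} {I : Ideal (MvPolynomial (V ⊕ V) K)}
    (hl : ∀ i, c i ∈ α → X (Sum.inl i) ∈ I) (hr : ∀ i, c i ∈ α → X (Sum.inr i) ∈ I)
    (hI : ∀ i j, c i = c j → edgeBinomial K i j ∈ I) : toricPrime K c α α ≤ I := by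
  classical
  have := Fintype.ofFinite V
  have hker : ∀ m : V ⊕ V →₀ ℕ, param K c α α (monomial m 1) = 0 → monomial m (1 : K) ∈ I := by
    intro m hm
    rcases param_monomial (K := K) c α m with ⟨⟨k, hk, hka⟩, -⟩ | h
    · have hX : (X k : MvPolynomial (V ⊕ V) K) ∈ I := by
        rcases k with i | i
        · exact hl i hka
        · exact hr i hka
      rw [monomial_eq]
      refine I.mul_mem_left _ ?_
      rw [Finsupp.prod]
      refine I.mem_of_dvd (Finset.dvd_prod_of_mem _ hk) (I.pow_mem_of_mem hX _ ?_)
      exact Nat.pos_of_ne_zero (Finsupp.mem_support_iff.1 hk)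
    · rw [h, monomial_eq_zero] at hm
      exact absurd hm one_ne_zero
  have hfib : ∀ m m' : V ⊕ V →₀ ℕ, param K c α α (monomial m 1) ≠ 0 →
      param K c α α (monomial m 1) = param K c α α (monomial m' 1) →
      monomial m (1 : K) - monomial m' 1 ∈ I := by
    intro m m' hm hmm
    have h := (param_monomial (K := K) c α m).resolve_left fun h => hm h.2
    have h' := (param_monomial (K := K) c α m').resolve_left fun h => hm (hmm.trans h.2)
    rw [h, h'] at hmm
    have heq := monomial_left_injective (one_ne_zero : (1 : K) ≠ 0) hmm
    refine monomial_sub_monomial_mem hI _ m m' ?_ ?_ le_rfl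
    · intro i
      have := DFunLike.congr_fun heq (Sum.inl i)
      simpa [mapDomain_apply_eq_sum, Fintype.sum_sum_type] using this
    · intro k
      have := DFunLike.congr_fun heq (Sum.inr (Sum.inr k))
      simpa [mapDomain_apply_eq_sum, Fintype.sum_sum_type, Finset.sum_filter] using this
  -- a linear map that sends the image of each monomial to the class of that monomial modulo `I`
  let ρ : MvPolynomial (V ⊕ (C ⊕ C)) K →ₗ[K] (MvPolynomial (V ⊕ V) K ⧸ I) :=
    (basisMonomials _ K).constr K fun e =>
      if h : ∃ m : V ⊕ V →₀ ℕ, param K c α α (monomial m 1) = monomial e 1 then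
        Ideal.Quotient.mk I (monomial h.choose 1) else 0
  have hρ : ρ ∘ₗ (param K c α α).toLinearMap = (Ideal.Quotient.mkₐ K I).toLinearMap := by
    refine (basisMonomials _ K).ext fun m => ?_
    simp only [coe_basisMonomials, LinearMap.comp_apply, AlgHom.toLinearMap_apply,
      Ideal.Quotient.mkₐ_eq_mk]
    by_cases h0 : param K c α α (monomial m 1) = 0
    · rw [h0, map_zero, eq_comm, Ideal.Quotient.eq_zero_iff_mem]
      exact hker m h0
    · obtain ⟨e, he⟩ : ∃ e, param K c α α (monomial m 1) = monomial e (1 : K) :=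
        ⟨_, (param_monomial (K := K) c α m).resolve_left fun h => h0 h.2⟩
      have hex : ∃ m : V ⊕ V →₀ ℕ, param K c α α (monomial m 1) = monomial e (1 : K) := ⟨m, he⟩
      have hc : ρ (monomial e 1) = Ideal.Quotient.mk I (monomial hex.choose 1) := by
        have := (basisMonomials _ K).constr_basis K (fun e =>
          if h : ∃ m : V ⊕ V →₀ ℕ, param K c α α (monomial m 1) = monomial e 1 then
          Ideal.Quotient.mk I (monomial h.choose 1) else 0) e
        rw [dif_pos hex, coe_basisMonomials] at this
        exact this
      rw [he, hc, Ideal.Quotient.eq]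
      refine hfib _ _ ?_ (hex.choose_spec.trans he.symm)
      rw [hex.choose_spec, ← he]
      exact h0
  intro f hf
  have := LinearMap.congr_fun hρ f
  simp only [LinearMap.comp_apply, AlgHom.toLinearMap_apply, Ideal.Quotient.mkₐ_eq_mk] at this
  rw [mem_toricPrime.1 hf, map_zero, eq_comm, Ideal.Quotient.eq_zero_iff_mem] at this
  exact this

end Toric

/-! ### Components and cutsets -/

section Avoid

variable {V : Type u}

/-- The graph obtained from `G` by isolating the vertices of `T`: it has the same vertex set, and
its edges are those of `G ∖ T`. Its components are those of `G ∖ T` and the singletons in `T`. -/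
def avoid (G : SimpleGraph V) (T : Set V) : SimpleGraph V where
  Adj a b := G.Adj a b ∧ a ∉ T ∧ b ∉ T
  symm := ⟨fun _ _ h => ⟨h.1.symm, h.2.2, h.2.1⟩⟩
  loopless := ⟨fun _ h => h.1.ne rfl⟩

theorem avoid_mono {G G' : SimpleGraph V} (h : G ≤ G') (T : Set V) : avoid G T ≤ avoid G' T :=
  fun _ _ hab => ⟨h hab.1, hab.2⟩

theorem avoid_anti (G : SimpleGraph V) {S T : Set V} (h : S ⊆ T) : avoid G T ≤ avoid G S :=
  fun _ _ hab => ⟨hab.1, fun ha => hab.2.1 (h ha), fun hb => hab.2.2 (h hb)⟩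

/-- Induction along a walk, with the steps as adjacencies. -/
theorem reachable_induction {H : SimpleGraph V} {a : V} {P : V → Prop} (h0 : P a)
    (hs : ∀ b c, P b → H.Adj b c → P c) {b : V} (h : H.Reachable a b) : P b := by
  rw [SimpleGraph.reachable_iff_reflTransGen] at h
  induction h with
  | refl => exact h0
  | tail _ hbc ih => exact hs _ _ ih hbc

variable {G : SimpleGraph V} {T : Set V}

theorem eq_of_reachable_avoid {a b : V} (ha : a ∈ T) (h : (avoid G T).Reachable a b) : a = b :=
  reachable_induction (H := avoid G T) (P := fun b => a = b) rfl
    (fun _ _ hb hbc => absurd (hb ▸ ha) hbc.2.1) h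

theorem notMem_of_reachable_avoid {a b : V} (ha : a ∉ T) (h : (avoid G T).Reachable a b) :
    b ∉ T := fun hb => ha (eq_of_reachable_avoid hb h.symm ▸ hb)

/-- The inclusion of `G ∖ T` into the graph on all vertices. -/
def induceHomAvoid (G : SimpleGraph V) (T : Set V) : G.induce Tᶜ →g avoid G T where
  toFun := Subtype.val
  map_rel' {x y} hxy := ⟨hxy, x.2, y.2⟩

theorem reachable_induce_iff {a b : V} (ha : a ∈ Tᶜ) (hb : b ∈ Tᶜ) :
    (G.induce Tᶜ).Reachable ⟨a, ha⟩ ⟨b, hb⟩ ↔ (avoid G T).Reachable a b := by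
  constructor
  · intro h
    exact h.map (induceHomAvoid G T)
  · intro h
    refine reachable_induction (H := avoid G T) (P := fun b => ∀ hb : b ∈ Tᶜ,
      (G.induce Tᶜ).Reachable ⟨a, ha⟩ ⟨b, hb⟩) (fun _ => .rfl) (fun c d hc hcd hd => ?_) h hb
    exact (hc hcd.2.1).trans (SimpleGraph.Adj.reachable (G := G.induce Tᶜ) hcd.1)

theorem card_component_avoid [Finite V] (G : SimpleGraph V) (T : Set V) :
    Nat.card (avoid G T).ConnectedComponent = T.ncard + numComponents G T := by
  let f : T ⊕ (G.induce Tᶜ).ConnectedComponent → (avoid G T).ConnectedComponent :=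
    Sum.elim (fun t => (avoid G T).connectedComponentMk t) (SimpleGraph.ConnectedComponent.map
      (induceHomAvoid G T))
  have hf : Function.Bijective f := by
    constructor
    · rintro (s | c) (t | d) h
      · exact congrArg _ (Subtype.ext
          (eq_of_reachable_avoid s.2 (SimpleGraph.ConnectedComponent.exact h)))
      · induction d using SimpleGraph.ConnectedComponent.ind with | _ d =>
        exact absurd s.2 (notMem_of_reachable_avoid d.2
          (SimpleGraph.ConnectedComponent.exact h).symm)
      · induction c using SimpleGraph.ConnectedComponent.ind with | _ c =>
        exact absurd t.2 (notMem_of_reachable_avoid c.2 (SimpleGraph.ConnectedComponent.exact h))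
      · induction c using SimpleGraph.ConnectedComponent.ind with | _ c =>
        induction d using SimpleGraph.ConnectedComponent.ind with | _ d =>
        exact congrArg _ (SimpleGraph.ConnectedComponent.sound
          ((reachable_induce_iff c.2 d.2).2 (SimpleGraph.ConnectedComponent.exact h)))
    · intro c
      induction c using SimpleGraph.ConnectedComponent.ind with | _ v =>
      by_cases hv : v ∈ T
      · exact ⟨Sum.inl ⟨v, hv⟩, rfl⟩
      · exact ⟨Sum.inr ((G.induce Tᶜ).connectedComponentMk ⟨v, hv⟩), rfl⟩
  rw [← Nat.card_eq_of_bijective f hf, Nat.card_sum, numComponents, Nat.card_coe_set_eq]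

/-- If the neighbours of `v` outside `T` lie in one component of `G ∖ T`, then restoring `v` joins
no two other vertices. -/
theorem reachable_avoid_of_reachable_diff {v : V}
    (hv : ∀ a b, G.Adj v a → G.Adj v b → a ∉ T → b ∉ T → (avoid G T).Reachable a b) {a b : V}
    (ha : a ≠ v) (hb : b ≠ v) (h : (avoid G (T \ {v})).Reachable a b) :
    (avoid G T).Reachable a b := by
  have hT : ∀ {x}, x ∉ T \ {v} → x ≠ v → x ∉ T := fun hx hxv hxT => hx ⟨hxT, hxv⟩
  refine (reachable_induction (P := fun b => (b ≠ v → (avoid G T).Reachable a b) ∧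
    (b = v → ∀ d, G.Adj v d → d ∉ T → (avoid G T).Reachable a d))
    ⟨fun _ => .rfl, fun h => absurd h ha⟩
    (fun x y hx hxy => ⟨fun hyv => ?_, ?_⟩) h).1 hb
  · by_cases hxv : x = v
    · exact hx.2 hxv _ (hxv ▸ hxy.1) (hT hxy.2.2 hyv)
    · exact (hx.1 hxv).trans
        (SimpleGraph.Adj.reachable ⟨hxy.1, hT hxy.2.1 hxv, hT hxy.2.2 hyv⟩)
  · rintro rfl d hd hdT
    have hxv : x ≠ y := hxy.1.ne
    exact (hx.1 hxv).trans (hv _ _ hxy.1.symm hd (hT hxy.2.1 hxv) hdT)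

/-- A set `T` is a cutset if and only if every vertex of `T` has neighbours in two different
components of `G ∖ T`. -/
theorem isCutset_iff [Finite V] : IsCutset G T ↔ ∀ v ∈ T, ∃ a b, G.Adj v a ∧ G.Adj v b ∧
    a ∉ T ∧ b ∉ T ∧ ¬ (avoid G T).Reachable a b := by
  refine forall₂_congr fun v hv => ?_
  have hS := card_component_avoid G (T \ {v})
  have hT := card_component_avoid G T
  have hc : (T \ {v}).ncard + 1 = T.ncard := Set.ncard_sdiff_singleton_add_one hv
  let f : (avoid G T).ConnectedComponent → (avoid G (T \ {v})).ConnectedComponent :=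
    SimpleGraph.ConnectedComponent.map (SimpleGraph.Hom.ofLE (avoid_anti G Set.sdiff_subset))
  have key : numComponents G (T \ {v}) < numComponents G T ↔
      Nat.card (avoid G (T \ {v})).ConnectedComponent + 1 <
        Nat.card (avoid G T).ConnectedComponent := by omega
  rw [key]
  constructor
  · contrapose!
    intro h
    -- away from the class of `v`, the map `f` is injective
    have hinj : Set.InjOn f {(avoid G T).connectedComponentMk v}ᶜ := by
      intro c hc d hd hcd
      induction c using SimpleGraph.ConnectedComponent.ind with | _ c =>
      induction d using SimpleGraph.ConnectedComponent.ind with | _ d =>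
      refine SimpleGraph.ConnectedComponent.sound (reachable_avoid_of_reachable_diff
        (fun a b ha hb haT hbT => h a b ha hb haT hbT) ?_ ?_
        (SimpleGraph.ConnectedComponent.exact hcd))
      · rintro rfl; exact hc rfl
      · rintro rfl; exact hd rfl
    have h1 := Set.ncard_le_ncard_of_injOn f (fun _ _ => Set.mem_univ _) hinj
    have h2 := Set.ncard_add_ncard_compl {(avoid G T).connectedComponentMk v}
    rw [Set.ncard_univ] at h1
    rw [Set.ncard_singleton] at h2
    omega
  · rintro ⟨a, b, hva, hvb, ha, hb, hab⟩
    let ca := (avoid G T).connectedComponentMk a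
    let cb := (avoid G T).connectedComponentMk b
    let cv := (avoid G T).connectedComponentMk v
    have hne : ca ≠ cb := fun h => hab (SimpleGraph.ConnectedComponent.exact h)
    have hav : ca ≠ cv := fun h => notMem_of_reachable_avoid ha
      (SimpleGraph.ConnectedComponent.exact h) hv
    have hbv : cb ≠ cv := fun h => notMem_of_reachable_avoid hb
      (SimpleGraph.ConnectedComponent.exact h) hv
    have hfa : f cv = f ca := SimpleGraph.ConnectedComponent.sound
      (SimpleGraph.Adj.reachable ⟨hva, by simp, fun h => ha h.1⟩)
    have hfb : f cv = f cb := SimpleGraph.ConnectedComponent.sound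
      (SimpleGraph.Adj.reachable ⟨hvb, by simp, fun h => hb h.1⟩)
    -- the classes of `a` and `b` are not needed to cover all classes
    have hsurj : Set.univ ⊆ f '' ({ca, cb} : Set _)ᶜ := by
      intro x _
      induction x using SimpleGraph.ConnectedComponent.ind with | _ x =>
      have hx : f ((avoid G T).connectedComponentMk x) =
        (avoid G (T \ {v})).connectedComponentMk x := rfl
      by_cases hxa : (avoid G T).connectedComponentMk x = ca
      · exact ⟨cv, by simp [hav.symm, hbv.symm], by rw [← hx, hxa, hfa]⟩
      by_cases hxb : (avoid G T).connectedComponentMk x = cb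
      · exact ⟨cv, by simp [hav.symm, hbv.symm], by rw [← hx, hxb, hfb]⟩
      exact ⟨_, by simp [hxa, hxb], hx⟩
    have h1 := (Set.ncard_le_ncard hsurj).trans (Set.ncard_image_le (Set.toFinite _))
    have h2 := Set.ncard_add_ncard_compl ({ca, cb} : Set _)
    rw [Set.ncard_univ] at h1
    rw [Set.ncard_pair hne] at h2
    omega

end Avoid

/-! ### The primes of a binomial edge ideal -/

section CutPrime

open MvPolynomial

variable (K : Type*) [Field K] {V : Type u}

/-- The prime ideal `P_T(G)` attached to a set `T` of vertices: the toric prime of the partition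
into the components of `G ∖ T` and the singletons in `T`, with the variables of `T` killed. -/
noncomputable def cutPrime (G : SimpleGraph V) (T : Set V) : Ideal (MvPolynomial (V ⊕ V) K) :=
  toricPrime K (avoid G T).connectedComponentMk ((avoid G T).connectedComponentMk '' T)
    ((avoid G T).connectedComponentMk '' T)

instance (G : SimpleGraph V) (T : Set V) : (cutPrime K G T).IsPrime :=
  inferInstanceAs (toricPrime K _ _ _).IsPrime

/-- The ideal generated by `J_G` and the variables of the vertices in `T`. -/
noncomputable def cutIdeal (G : SimpleGraph V) (T : Set V) : Ideal (MvPolynomial (V ⊕ V) K) :=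
  Ideal.span (X '' (Sum.inl '' T)) ⊔ Ideal.span (X '' (Sum.inr '' T)) ⊔ binomialEdgeIdeal K G

variable {K} {G : SimpleGraph V} {T : Set V}

theorem mk_mem_image_iff {i : V} :
    (avoid G T).connectedComponentMk i ∈ (avoid G T).connectedComponentMk '' T ↔ i ∈ T := by
  constructor
  · rintro ⟨t, ht, h⟩
    rwa [← eq_of_reachable_avoid ht (SimpleGraph.ConnectedComponent.exact h)]
  · exact fun h => ⟨i, h, rfl⟩

theorem X_inl_mem_cutPrime {i : V} :
    (X (Sum.inl i) : MvPolynomial (V ⊕ V) K) ∈ cutPrime K G T ↔ i ∈ T :=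
  X_inl_mem_toricPrime.trans mk_mem_image_iff

theorem X_inr_mem_cutPrime {i : V} :
    (X (Sum.inr i) : MvPolynomial (V ⊕ V) K) ∈ cutPrime K G T ↔ i ∈ T :=
  X_inr_mem_toricPrime.trans mk_mem_image_iff

theorem edgeBinomial_mem_cutPrime {i j : V} :
    edgeBinomial K i j ∈ cutPrime K G T ↔ (avoid G T).Reachable i j ∨ i ∈ T ∨ j ∈ T := by
  rw [cutPrime, edgeBinomial_mem_toricPrime, mk_mem_image_iff, mk_mem_image_iff,
    SimpleGraph.ConnectedComponent.eq]

theorem cutPrime_le {I : Ideal (MvPolynomial (V ⊕ V) K)} [Finite V]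
    (hl : ∀ i ∈ T, X (Sum.inl i) ∈ I) (hr : ∀ i ∈ T, X (Sum.inr i) ∈ I)
    (hI : ∀ i j, (avoid G T).Reachable i j → edgeBinomial K i j ∈ I) : cutPrime K G T ≤ I :=
  toricPrime_le (fun i hi => hl i (mk_mem_image_iff.1 hi))
    (fun i hi => hr i (mk_mem_image_iff.1 hi))
    fun i j hij => hI i j (SimpleGraph.ConnectedComponent.exact hij)

theorem cutPrime_mono {G' : SimpleGraph V} (h : G ≤ G') (T : Set V) :
    cutPrime K G T ≤ cutPrime K G' T := by
  refine toricPrime_mono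
    (SimpleGraph.ConnectedComponent.map (SimpleGraph.Hom.ofLE (avoid_mono h T))) (fun _ => rfl)
    ?_ ?_ <;>
  · rintro _ ⟨t, ht, rfl⟩
    exact ⟨t, ht, rfl⟩

theorem edgeBinomial_self (i : V) : edgeBinomial K i i = 0 := sub_self _

theorem edgeBinomial_mem_binomialEdgeIdeal {i j : V} (h : G.Adj i j) :
    edgeBinomial K i j ∈ binomialEdgeIdeal K G := Ideal.subset_span ⟨i, j, h, rfl⟩

theorem binomialEdgeIdeal_le {I : Ideal (MvPolynomial (V ⊕ V) K)}
    (h : ∀ i j, G.Adj i j → edgeBinomial K i j ∈ I) : binomialEdgeIdeal K G ≤ I := by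
  refine Ideal.span_le.2 ?_
  rintro _ ⟨i, j, hij, rfl⟩
  exact h i j hij

theorem cutIdeal_le {I : Ideal (MvPolynomial (V ⊕ V) K)} (hl : ∀ i ∈ T, X (Sum.inl i) ∈ I)
    (hr : ∀ i ∈ T, X (Sum.inr i) ∈ I) (h : ∀ i j, G.Adj i j → edgeBinomial K i j ∈ I) :
    cutIdeal K G T ≤ I := by
  refine sup_le (sup_le ?_ ?_) (binomialEdgeIdeal_le h)
  · rw [Ideal.span_le]; rintro _ ⟨_, ⟨i, hi, rfl⟩, rfl⟩; exact hl i hi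
  · rw [Ideal.span_le]; rintro _ ⟨_, ⟨i, hi, rfl⟩, rfl⟩; exact hr i hi

theorem X_inl_mem_cutIdeal {i : V} (h : i ∈ T) : X (Sum.inl i) ∈ cutIdeal K G T :=
  Ideal.mem_sup_left (Ideal.mem_sup_left (Ideal.subset_span ⟨_, ⟨i, h, rfl⟩, rfl⟩))

theorem X_inr_mem_cutIdeal {i : V} (h : i ∈ T) : X (Sum.inr i) ∈ cutIdeal K G T :=
  Ideal.mem_sup_left (Ideal.mem_sup_right (Ideal.subset_span ⟨_, ⟨i, h, rfl⟩, rfl⟩))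

theorem edgeBinomial_mem_cutIdeal {i j : V} (h : G.Adj i j) :
    edgeBinomial K i j ∈ cutIdeal K G T :=
  Ideal.mem_sup_right (edgeBinomial_mem_binomialEdgeIdeal h)

/-- The graph obtained from `G` by joining all neighbours of `v` to each other. -/
def completeAt (G : SimpleGraph V) (v : V) : SimpleGraph V where
  Adj a b := G.Adj a b ∨ (a ≠ b ∧ G.Adj v a ∧ G.Adj v b)
  symm := ⟨fun _ _ h => h.imp SimpleGraph.Adj.symm fun h => ⟨h.1.symm, h.2.2, h.2.1⟩⟩
  loopless := ⟨fun _ h => h.elim (fun h => h.ne rfl) fun h => h.1 rfl⟩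

open Classical in
/-- The substitution of `0` for the two variables of the vertex `v`. -/
noncomputable def killVertex (v : V) : MvPolynomial (V ⊕ V) K →ₐ[K] MvPolynomial (V ⊕ V) K :=
  aeval fun k => if Sum.elim id id k = v then 0 else X k

theorem killVertex_X_inl (v i : V) [Decidable (i = v)] :
    killVertex (K := K) v (X (Sum.inl i)) = if i = v then 0 else X (Sum.inl i) := by
  simp only [killVertex, aeval_X, Sum.elim_inl, id]
  congr

theorem killVertex_X_inr (v i : V) [Decidable (i = v)] :
    killVertex (K := K) v (X (Sum.inr i)) = if i = v then 0 else X (Sum.inr i) := by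
  simp only [killVertex, aeval_X, Sum.elim_inr, id]
  congr

theorem killVertex_edgeBinomial (v i j : V) [Decidable (i = v ∨ j = v)] :
    killVertex v (edgeBinomial K i j) = if i = v ∨ j = v then 0 else edgeBinomial K i j := by
  classical
  simp only [edgeBinomial, map_sub, map_mul, killVertex_X_inl, killVertex_X_inr]
  by_cases hi : i = v <;> by_cases hj : j = v <;> simp [hi, hj]

theorem sub_killVertex_mem {I : Ideal (MvPolynomial (V ⊕ V) K)} {v : V}
    (hl : X (Sum.inl v) ∈ I) (hr : X (Sum.inr v) ∈ I) (p : MvPolynomial (V ⊕ V) K) :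
    p - killVertex v p ∈ I := by
  classical
  have h : (Ideal.Quotient.mkₐ K I).comp (killVertex v) = Ideal.Quotient.mkₐ K I := by
    refine MvPolynomial.algHom_ext fun k => ?_
    rcases k with i | i
    · by_cases hi : i = v
      · subst hi
        simpa [killVertex_X_inl, eq_comm] using Ideal.Quotient.eq_zero_iff_mem.2 hl
      · simp [killVertex_X_inl, hi]
    · by_cases hi : i = v
      · subst hi
        simpa [killVertex_X_inr, eq_comm] using Ideal.Quotient.eq_zero_iff_mem.2 hr
      · simp [killVertex_X_inr, hi]
  rw [← Ideal.Quotient.eq]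
  exact (DFunLike.congr_fun h p).symm

/-- The intersection of the ideals for `(completeAt G v, T)` and for `(G, T ∪ {v})` is contained in
the ideal for `(G, T)`. The point is that the binomial of two neighbours `a`, `b` of `v` is
multiplied into `J_G` by `x_v` and `y_v`: an element of the first ideal is therefore congruent to a
combination of such binomials whose coefficients do not involve `x_v`, `y_v`. -/
theorem mem_cutIdeal_of_mem_completeAt {v : V} {f : MvPolynomial (V ⊕ V) K}
    (h1 : f ∈ cutIdeal K (completeAt G v) T) (h2 : f ∈ cutIdeal K G (insert v T)) :
    f ∈ cutIdeal K G T := by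
  classical
  let D : Ideal (MvPolynomial (V ⊕ V) K) :=
    Ideal.span {g | ∃ a b, G.Adj v a ∧ G.Adj v b ∧ g = edgeBinomial K a b}
  have hle : cutIdeal K (completeAt G v) T ≤ cutIdeal K G T ⊔ D := by
    refine cutIdeal_le (fun i hi => Ideal.mem_sup_left (X_inl_mem_cutIdeal hi))
      (fun i hi => Ideal.mem_sup_left (X_inr_mem_cutIdeal hi)) ?_
    rintro i j (hij | ⟨-, hi, hj⟩)
    · exact Ideal.mem_sup_left (edgeBinomial_mem_cutIdeal hij)
    · exact Ideal.mem_sup_right (Ideal.subset_span ⟨i, j, hi, hj, rfl⟩)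
  have hv : ∀ k d, d ∈ D → Sum.elim id id k = v → X k * d ∈ cutIdeal K G T := by
    intro k d hd hk
    rw [mul_comm]
    refine Submodule.mem_colon_singleton.1 ((Ideal.span_le (I := (cutIdeal K G T).colon {X k})).2
      ?_ hd)
    rintro _ ⟨a, b, ha, hb, rfl⟩
    refine Submodule.mem_colon_singleton.2 ?_
    rcases k with w | w
    · obtain rfl : w = v := hk
      have e : edgeBinomial K a b • X (Sum.inl w) =
          X (Sum.inl a) * edgeBinomial K w b - X (Sum.inl b) * edgeBinomial K w a := by
        simp only [edgeBinomial, smul_eq_mul]; ring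
      rw [e]
      exact Ideal.sub_mem _ (Ideal.mul_mem_left _ _ (edgeBinomial_mem_cutIdeal hb))
        (Ideal.mul_mem_left _ _ (edgeBinomial_mem_cutIdeal ha))
    · obtain rfl : w = v := hk
      have e : edgeBinomial K a b • X (Sum.inr w) =
          X (Sum.inr a) * edgeBinomial K w b - X (Sum.inr b) * edgeBinomial K w a := by
        simp only [edgeBinomial, smul_eq_mul]; ring
      rw [e]
      exact Ideal.sub_mem _ (Ideal.mul_mem_left _ _ (edgeBinomial_mem_cutIdeal hb))
        (Ideal.mul_mem_left _ _ (edgeBinomial_mem_cutIdeal ha))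
  have hD : ∀ d ∈ D, d - killVertex v d ∈ cutIdeal K G T := by
    intro d hd
    refine Submodule.span_induction ?_ (by simp) ?_ ?_ hd
    · rintro _ ⟨a, b, ha, hb, rfl⟩
      rw [killVertex_edgeBinomial, if_neg (by simp [ha.ne', hb.ne']), sub_self]
      exact Ideal.zero_mem _
    · intro x y _ _ hx hy
      rw [map_add, add_sub_add_comm]
      exact Ideal.add_mem _ hx hy
    · intro p x hxD hx
      have hl : X (Sum.inl v) * x ∈ cutIdeal K G T := hv _ x hxD rfl
      have hr : X (Sum.inr v) * x ∈ cutIdeal K G T := hv _ x hxD rfl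
      have hp := sub_killVertex_mem (I := (cutIdeal K G T).colon {x}) (v := v)
        (Submodule.mem_colon_singleton.2 hl) (Submodule.mem_colon_singleton.2 hr) p
      rw [Submodule.mem_colon_singleton, smul_eq_mul] at hp
      have e : p • x - killVertex v (p • x) =
          (p - killVertex v p) * x + killVertex v p * (x - killVertex v x) := by
        rw [smul_eq_mul, map_mul]; ring
      rw [e]
      exact Ideal.add_mem _ hp (Ideal.mul_mem_left _ _ hx)
  have hkill : ∀ d ∈ cutIdeal K G (insert v T), killVertex v d ∈ cutIdeal K G T := by
    intro d hd
    refine (cutIdeal_le (I := (cutIdeal K G T).comap (killVertex v).toRingHom) ?_ ?_ ?_) hd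
    · intro i hi
      simp only [AlgHom.toRingHom_eq_coe, Ideal.mem_comap, RingHom.coe_coe, killVertex_X_inl]
      split_ifs with h
      · exact Ideal.zero_mem _
      · exact X_inl_mem_cutIdeal (hi.resolve_left h)
    · intro i hi
      simp only [AlgHom.toRingHom_eq_coe, Ideal.mem_comap, RingHom.coe_coe, killVertex_X_inr]
      split_ifs with h
      · exact Ideal.zero_mem _
      · exact X_inr_mem_cutIdeal (hi.resolve_left h)
    · intro i j hij
      simp only [AlgHom.toRingHom_eq_coe, Ideal.mem_comap, RingHom.coe_coe, killVertex_edgeBinomial]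
      split_ifs with h
      · exact Ideal.zero_mem _
      · exact edgeBinomial_mem_cutIdeal hij
  obtain ⟨g, hg, d, hd, rfl⟩ := Submodule.mem_sup.1 (hle h1)
  have hdI : d ∈ cutIdeal K G (insert v T) := by
    have hgI : g ∈ cutIdeal K G (insert v T) := cutIdeal_le
      (fun i hi => X_inl_mem_cutIdeal (Or.inr hi)) (fun i hi => X_inr_mem_cutIdeal (Or.inr hi))
      (fun i j hij => edgeBinomial_mem_cutIdeal hij) hg
    simpa using Ideal.sub_mem _ h2 hgI
  refine Ideal.add_mem _ hg ?_
  simpa using Ideal.add_mem _ (hD d hd) (hkill d hdI)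

/-- An element that lies in all `P_{T'}(G)` with `T ⊆ T'` lies in the ideal generated by `J_G` and
the variables of `T`. By `mem_cutIdeal_of_mem_completeAt` one may enlarge `T` or complete the
neighbourhood of a vertex, until adjacency is transitive outside `T` and the ideal is prime. -/
theorem mem_cutIdeal_of_forall_mem_cutPrime [Finite V] {f : MvPolynomial (V ⊕ V) K} (T : Set V) :
    ∀ G : SimpleGraph V, (∀ T' : Set V, T ⊆ T' → f ∈ cutPrime K G T') → f ∈ cutIdeal K G T := by
  induction T using WellFoundedGT.induction with | _ T ihT =>
  intro G
  induction G using WellFoundedGT.induction with | _ G ihG =>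
  intro hf
  by_cases htr : ∀ v a b, v ∉ T → a ∉ T → b ∉ T → G.Adj v a → G.Adj v b → a ≠ b → G.Adj a b
  · refine cutPrime_le (fun i hi => X_inl_mem_cutIdeal hi) (fun i hi => X_inr_mem_cutIdeal hi) ?_
      (hf T subset_rfl)
    intro i j hij
    have : i = j ∨ (avoid G T).Adj i j := by
      refine reachable_induction (P := fun j => i = j ∨ (avoid G T).Adj i j) (Or.inl rfl) ?_ hij
      rintro b c (rfl | hb) hbc
      · exact Or.inr hbc
      · by_cases hic : i = c
        · exact Or.inl hic
        · exact Or.inr ⟨htr b i c hb.2.2 hb.2.1 hbc.2.2 hb.1.symm hbc.1 hic, hb.2.1, hbc.2.2⟩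
    rcases this with rfl | h
    · rw [edgeBinomial_self]; exact Ideal.zero_mem _
    · exact edgeBinomial_mem_cutIdeal h.1
  · push Not at htr
    obtain ⟨v, a, b, hv, -, -, hva, hvb, hne, hab⟩ := htr
    have hlt : G < completeAt G v :=
      lt_of_le_of_ne (fun _ _ h => Or.inl h) fun h => hab (by rw [h]; exact Or.inr ⟨hne, hva, hvb⟩)
    refine mem_cutIdeal_of_mem_completeAt (v := v) ?_ ?_
    · exact ihG _ hlt fun T' hT' => cutPrime_mono hlt.le _ (hf T' hT')
    · exact ihT _ (Set.ssubset_insert hv) G fun T' hT' => hf T' ((Set.subset_insert _ _).trans hT')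

theorem binomialEdgeIdeal_le_cutPrime (G : SimpleGraph V) (T : Set V) :
    binomialEdgeIdeal K G ≤ cutPrime K G T := by
  refine binomialEdgeIdeal_le fun i j hij => edgeBinomial_mem_cutPrime.2 ?_
  by_cases hi : i ∈ T
  · exact Or.inr (Or.inl hi)
  by_cases hj : j ∈ T
  · exact Or.inr (Or.inr hj)
  exact Or.inl (SimpleGraph.Adj.reachable ⟨hij, hi, hj⟩)

/-- The binomial edge ideal is the intersection of the primes `P_T(G)`; in particular it is
radical. -/
theorem mem_binomialEdgeIdeal_iff [Finite V] {f : MvPolynomial (V ⊕ V) K} :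
    f ∈ binomialEdgeIdeal K G ↔ ∀ T, f ∈ cutPrime K G T := by
  constructor
  · exact fun h T => binomialEdgeIdeal_le_cutPrime G T h
  · intro h
    have := mem_cutIdeal_of_forall_mem_cutPrime ∅ G fun T' _ => h T'
    simpa [cutIdeal] using this

/-- The prime `P_T(G)` is minimal among all `P_S(G)` if and only if `T` is a cutset. -/
theorem isCutset_iff_minimal_cutPrime [Finite V] :
    IsCutset G T ↔ ∀ S, cutPrime K G S ≤ cutPrime K G T → S = T := by
  constructor
  · intro hT S hS
    have hST : S ⊆ T := fun i hi => X_inl_mem_cutPrime.1 (hS (X_inl_mem_cutPrime (K := K).2 hi))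
    refine hST.antisymm fun v hv => ?_
    by_contra hvS
    obtain ⟨a, b, hva, hvb, ha, hb, hab⟩ := isCutset_iff.1 hT v hv
    have h1 : (avoid G S).Reachable v a :=
      SimpleGraph.Adj.reachable ⟨hva, hvS, fun h => ha (hST h)⟩
    have h2 : (avoid G S).Reachable v b :=
      SimpleGraph.Adj.reachable ⟨hvb, hvS, fun h => hb (hST h)⟩
    rcases edgeBinomial_mem_cutPrime.1 (hS (edgeBinomial_mem_cutPrime (K := K).2
      (Or.inl (h1.symm.trans h2)))) with h | h | h
    exacts [hab h, ha h, hb h]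
  · intro hT
    rw [isCutset_iff]
    by_contra! hno
    obtain ⟨v, hv, hno⟩ := hno
    have := hT (T \ {v}) (cutPrime_le (fun i hi => X_inl_mem_cutPrime.2 hi.1)
      (fun i hi => X_inr_mem_cutPrime.2 hi.1) fun i j hij => edgeBinomial_mem_cutPrime.2 ?_)
    · rw [← this] at hv
      exact hv.2 rfl
    · by_cases hi : i ∈ T
      · exact Or.inr (Or.inl hi)
      by_cases hj : j ∈ T
      · exact Or.inr (Or.inr hj)
      refine Or.inl (reachable_avoid_of_reachable_diff hno ?_ ?_ hij)
      · rintro rfl; exact hi hv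
      · rintro rfl; exact hj hv

/-- The associated primes of `S / J_G` are the `P_T(G)` of the cutsets `T`. -/
theorem mem_associatedPrimes_binomialEdgeIdeal_iff [Finite V]
    {P : Ideal (MvPolynomial (V ⊕ V) K)} :
    P ∈ associatedPrimes (MvPolynomial (V ⊕ V) K) (MvPolynomial (V ⊕ V) K ⧸ binomialEdgeIdeal K G) ↔
      ∃ T, IsCutset G T ∧ P = cutPrime K G T := by
  classical
  -- a prime containing an intersection of some of the `P_T(G)` contains one of them
  have hinf : ∀ (Q : Ideal (MvPolynomial (V ⊕ V) K)) [Q.IsPrime] (p : Set V → Prop),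
      (∀ r, (∀ T, p T → r ∈ cutPrime K G T) → r ∈ Q) → ∃ T, p T ∧ cutPrime K G T ≤ Q := by
    intro Q hQ p h
    have := Fintype.ofFinite (Set V)
    obtain ⟨T, hT, hle⟩ := (Ideal.IsPrime.inf_le' (s := Finset.univ.filter p)
      (f := cutPrime K G) hQ).1 (fun r hr => h r fun T hT =>
        (Submodule.mem_finsetInf.1 hr) T (by simpa using hT))
    exact ⟨T, by simpa using hT, hle⟩
  constructor
  · intro hP
    obtain ⟨hprime, x, hx⟩ := isAssociatedPrime_iff.1 (AssociatedPrimes.mem_iff.1 hP)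
    obtain ⟨f, rfl⟩ := Ideal.Quotient.mk_surjective x
    have hmem : ∀ r, r ∈ P ↔ r * f ∈ binomialEdgeIdeal K G := by
      intro r
      rw [hx, Submodule.mem_colon_singleton, Submodule.mem_bot, ← Ideal.Quotient.eq_zero_iff_mem,
        map_mul]
      rfl
    have hsub : ∀ T, f ∉ cutPrime K G T → P ≤ cutPrime K G T := fun T hT r hr =>
      ((inferInstance : (cutPrime K G T).IsPrime).mem_or_mem
        (mem_binomialEdgeIdeal_iff.1 ((hmem r).1 hr) T)).resolve_right hT
    obtain ⟨T, hfT, hT⟩ := hinf P (fun T => f ∉ cutPrime K G T) fun r hr => (hmem r).2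
      (mem_binomialEdgeIdeal_iff.2 fun T => by
        by_cases hfT : f ∈ cutPrime K G T
        · exact Ideal.mul_mem_left _ _ hfT
        · exact Ideal.mul_mem_right _ _ (hr T hfT))
    have hPT : P = cutPrime K G T := le_antisymm (hsub T hfT) hT
    refine ⟨T, (isCutset_iff_minimal_cutPrime (K := K)).2 fun S hS => ?_, hPT⟩
    have h1 : cutPrime K G T ≤ cutPrime K G S := hPT ▸ hsub S fun h => hfT (hS h)
    ext i
    rw [← X_inl_mem_cutPrime (K := K) (G := G), ← X_inl_mem_cutPrime (K := K) (G := G) (T := T)]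
    exact ⟨fun h => hS h, fun h => h1 h⟩
  · rintro ⟨T, hT, rfl⟩
    refine Module.associatedPrimes.minimalPrimes_annihilator_subset_associatedPrimes _ _ ?_
    rw [Ideal.annihilator_quotient]
    refine ⟨⟨inferInstance, binomialEdgeIdeal_le_cutPrime G T⟩, fun Q hQ hQT => ?_⟩
    have := hQ.1
    obtain ⟨S, -, hS⟩ := hinf Q (fun _ => True) fun r hr =>
      hQ.2 (mem_binomialEdgeIdeal_iff.2 fun T => hr T trivial)
    have := (isCutset_iff_minimal_cutPrime (K := K)).1 hT S (hS.trans hQT)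
    exact this ▸ hS

end CutPrime

/-! ### Heights and unmixedness -/

section Height

open MvPolynomial

variable {K : Type*} [Field K] {V : Type u}

/-- An upper bound for the height of a toric prime, from Krull's height theorem: choosing a
representative `r` of each class, the prime is minimal over the ideal generated by the variables of
the killed classes and the binomials of the pairs `(r, i)`, because `x_r` is not in the prime unless
its class is killed. -/
theorem height_toricPrime_le [Finite V] {C : Type*} [Finite C] {c : V → C}
    (hc : Function.Surjective c) {α : Set C} (hα : ∀ i j, c i ∈ α → c i = c j → i = j) :
    (toricPrime K c α α).height + Nat.card C ≤ ((Nat.card V + α.ncard + α.ncard : ℕ) : ℕ∞) := by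
  classical
  let r : C → V := Function.surjInv hc
  have hr : ∀ k, c (r k) = k := Function.surjInv_eq hc
  let s : Set (MvPolynomial (V ⊕ V) K) := (fun i => edgeBinomial K (r (c i)) i) '' (Set.range r)ᶜ ∪
    (fun k => X (Sum.inl (r k))) '' α ∪ (fun k => X (Sum.inr (r k))) '' α
  have hmin : toricPrime K c α α ∈ (Ideal.span s).minimalPrimes := by
    refine ⟨⟨inferInstance, Ideal.span_le.2 ?_⟩, ?_⟩
    · rintro _ ((⟨i, -, rfl⟩ | ⟨k, hk, rfl⟩) | ⟨k, hk, rfl⟩)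
      · exact edgeBinomial_mem_toricPrime.2 (Or.inl (hr _))
      · exact X_inl_mem_toricPrime.2 (by rwa [hr])
      · exact X_inr_mem_toricPrime.2 (by rwa [hr])
    · rintro Q ⟨hQ, hsQ⟩ hQP
      have hrep : ∀ i, c i ∈ α → r (c i) = i := fun i hi =>
        hα _ _ (by rwa [hr]) (hr _)
      have hl : ∀ i, c i ∈ α → X (Sum.inl i) ∈ Q := fun i hi =>
        hsQ (Ideal.subset_span (Or.inl (Or.inr ⟨c i, hi, by simp only [hrep i hi]⟩)))
      have hl' : ∀ i, c i ∈ α → X (Sum.inr i) ∈ Q := fun i hi =>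
        hsQ (Ideal.subset_span (Or.inr ⟨c i, hi, by simp only [hrep i hi]⟩))
      have hroot : ∀ i, edgeBinomial K (r (c i)) i ∈ Q := by
        intro i
        by_cases hi : i ∈ Set.range r
        · obtain ⟨k, rfl⟩ := hi
          rw [hr, edgeBinomial_self]
          exact Q.zero_mem
        · exact hsQ (Ideal.subset_span (Or.inl (Or.inl ⟨i, hi, rfl⟩)))
      refine toricPrime_le hl hl' fun i j hij => ?_
      by_cases hi : c i ∈ α
      · rw [hα i j hi hij, edgeBinomial_self]
        exact Q.zero_mem
      · have hx : (X (Sum.inl (r (c i))) : MvPolynomial (V ⊕ V) K) ∉ Q := fun h =>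
          hi (by simpa [hr] using X_inl_mem_toricPrime.1 (hQP h))
        refine (hQ.mem_or_mem (x := X (Sum.inl (r (c i)))) ?_).resolve_left hx
        have e : X (Sum.inl (r (c i))) * edgeBinomial K i j =
            X (Sum.inl i) * edgeBinomial K (r (c i)) j -
              X (Sum.inl j) * edgeBinomial K (r (c i)) i := by
          simp only [edgeBinomial]; ring
        rw [e]
        refine Q.sub_mem (Q.mul_mem_left _ ?_) (Q.mul_mem_left _ (hroot i))
        rw [hij]
        exact hroot j
  have h1 := Ideal.height_le_card_of_mem_minimalPrimes_span (Set.toFinite s) hmin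
  have h2 : s.ncard ≤ (Set.range r)ᶜ.ncard + α.ncard + α.ncard :=
    (Set.ncard_union_le _ _).trans (add_le_add ((Set.ncard_union_le _ _).trans (add_le_add
      (Set.ncard_image_le (Set.toFinite _)) (Set.ncard_image_le (Set.toFinite _))))
      (Set.ncard_image_le (Set.toFinite _)))
  have h3 := Set.ncard_add_ncard_compl (Set.range r)
  have h4 : (Set.range r).ncard = Nat.card C := by
    rw [← Set.image_univ, Set.ncard_image_of_injective _ (Function.injective_surjInv hc),
      Set.ncard_univ]
  calc (toricPrime K c α α).height + Nat.card C ≤ (s.ncard : ℕ∞) + Nat.card C := by gcongr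
    _ = ((s.ncard + Nat.card C : ℕ) : ℕ∞) := by push_cast; rfl
    _ ≤ _ := by norm_cast; omega

/-- The height of `P_T(G)` is `|V| + |T| - c_G(T)`. -/
theorem height_cutPrime [Finite V] (G : SimpleGraph V) (T : Set V) :
    (cutPrime K G T).height + numComponents G T = ((Nat.card V + T.ncard : ℕ) : ℕ∞) := by
  have hc : Function.Surjective (avoid G T).connectedComponentMk := Quot.mk_surjective
  have hn : ((avoid G T).connectedComponentMk '' T).ncard = T.ncard :=
    Set.InjOn.ncard_image fun a ha b _ h =>
      eq_of_reachable_avoid ha (SimpleGraph.ConnectedComponent.exact h)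
  have h1 := height_toricPrime_le (K := K) hc (α := (avoid G T).connectedComponentMk '' T)
    fun i j hi h => eq_of_reachable_avoid (mk_mem_image_iff.1 hi)
      (SimpleGraph.ConnectedComponent.exact h)
  have h2 := card_add_ncard_le_height_toricPrime (K := K) hc
    ((avoid G T).connectedComponentMk '' T) ((avoid G T).connectedComponentMk '' T)
  have h3 := le_antisymm h1 h2
  rw [card_component_avoid, hn] at h3
  have h4 : (cutPrime K G T).height + numComponents G T + T.ncard =
      ((Nat.card V + T.ncard : ℕ) : ℕ∞) + T.ncard := by
    rw [cutPrime, add_assoc, ← Nat.cast_add, add_comm (numComponents G T), h3]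
    push_cast; rfl
  exact (ENat.add_left_injective_of_ne_top (ENat.natCast_ne_top _)) h4

/-- For a connected graph, `J_G` is unmixed if and only if `c_G(T) = |T| + 1` for all cutsets. -/
theorem isUnmixed_iff [Finite V] {G : SimpleGraph V} (hG : G.Connected) :
    IsUnmixed (binomialEdgeIdeal K G) ↔ ∀ T, IsCutset G T → numComponents G T = T.ncard + 1 := by
  have hempty : numComponents G ∅ = 1 := by
    have h1 := card_component_avoid G ∅
    have h2 : avoid G ∅ = G := by ext; simp [avoid]
    rw [h2, Set.ncard_empty, zero_add] at h1
    have := hG.preconnected.subsingleton_connectedComponent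
    have := hG.nonempty.map G.connectedComponentMk
    rw [← h1, Nat.card_eq_one_iff_unique]
    exact ⟨inferInstance, inferInstance⟩
  constructor
  · intro h T hT
    have h0 := h _ (mem_associatedPrimes_binomialEdgeIdeal_iff.2 ⟨T, hT, rfl⟩) _
      (mem_associatedPrimes_binomialEdgeIdeal_iff.2 ⟨∅, by simp [IsCutset], rfl⟩)
    have h1 := height_cutPrime (K := K) G T
    have h2 := height_cutPrime (K := K) G ∅
    rw [h0] at h1
    rw [hempty] at h2
    have hfin : (cutPrime K G ∅).height ≠ ⊤ := by
      intro htop; rw [htop] at h2; simp at h2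
    lift (cutPrime K G ∅).height to ℕ using hfin with n
    rw [Set.ncard_empty] at h2
    norm_cast at h1 h2
    omega
  · intro h P hP Q hQ
    obtain ⟨S, hS, rfl⟩ := mem_associatedPrimes_binomialEdgeIdeal_iff.1 hP
    obtain ⟨T, hT, rfl⟩ := mem_associatedPrimes_binomialEdgeIdeal_iff.1 hQ
    have key : ∀ T, IsCutset G T → (cutPrime K G T).height + 1 = (Nat.card V : ℕ∞) := by
      intro T hT
      have h1 := height_cutPrime (K := K) G T
      rw [h T hT] at h1
      refine ENat.add_left_injective_of_ne_top (ENat.natCast_ne_top T.ncard) ?_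
      simp only
      push_cast at h1
      rw [← h1, add_assoc, add_comm 1]
    exact ENat.add_left_injective_of_ne_top ENat.one_ne_top ((key S hS).trans (key T hT).symm)

end Height

/-! ### Blocks -/

section Block

variable {V : Type u} {G : SimpleGraph V}

theorem avoid_empty (G : SimpleGraph V) : avoid G ∅ = G := by ext; simp [avoid]

theorem reachable_avoid_induce_iff {s : Set V} {T : Set s} {a b : s} :
    (avoid (G.induce s) T).Reachable a b ↔
      (avoid G (sᶜ ∪ Subtype.val '' T)).Reachable (a : V) b := by
  have hmem : ∀ x : s, (x : V) ∈ sᶜ ∪ Subtype.val '' T ↔ x ∈ T := fun x => by simp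
  constructor
  · intro h
    refine reachable_induction (H := avoid (G.induce s) T)
      (P := fun b => (avoid G (sᶜ ∪ Subtype.val '' T)).Reachable (a : V) b) .rfl ?_ h
    exact fun c d hc hcd => hc.trans
      (SimpleGraph.Adj.reachable ⟨hcd.1, by rw [hmem]; exact hcd.2.1, by rw [hmem]; exact hcd.2.2⟩)
  · intro h
    refine reachable_induction (H := avoid G (sᶜ ∪ Subtype.val '' T))
      (P := fun b => ∀ hb : b ∈ s, (avoid (G.induce s) T).Reachable a ⟨b, hb⟩)
      (fun _ => .rfl) (fun c d hc hcd hd => ?_) h b.2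
    have hcs : c ∈ s := by
      by_contra hcs
      exact hcd.2.1 (Or.inl hcs)
    refine (hc hcs).trans (SimpleGraph.Adj.reachable (G := avoid (G.induce s) T) ⟨hcd.1, ?_, ?_⟩)
    · exact fun h => hcd.2.1 (Or.inr ⟨_, h, rfl⟩)
    · exact fun h => hcd.2.2 (Or.inr ⟨_, h, rfl⟩)

/-- A graph induced on `s` is connected without cutpoints if and only if `s` is nonempty and
connected, and remains so (or becomes empty) when one vertex is removed. -/
theorem connected_and_forall_not_isCutpoint_iff [Finite V] {s : Set V} :
    ((G.induce s).Connected ∧ ∀ v : s, ¬ IsCutpoint (G.induce s) v) ↔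
      s.Nonempty ∧ (∀ a ∈ s, ∀ b ∈ s, (avoid G sᶜ).Reachable a b) ∧
        ∀ v ∈ s, ∀ a ∈ s, ∀ b ∈ s, a ≠ v → b ≠ v → (avoid G (sᶜ ∪ {v})).Reachable a b := by
  have hconn : (G.induce s).Connected ↔
      s.Nonempty ∧ ∀ a ∈ s, ∀ b ∈ s, (avoid G sᶜ).Reachable a b := by
    have key : ∀ a b : s, (G.induce s).Reachable a b ↔ (avoid G sᶜ).Reachable (a : V) b := by
      intro a b
      have := reachable_avoid_induce_iff (G := G) (s := s) (T := ∅) (a := a) (b := b)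
      rwa [avoid_empty, Set.image_empty, Set.union_empty] at this
    rw [SimpleGraph.connected_iff, and_comm, Set.nonempty_coe_sort]
    refine and_congr_right fun _ => ⟨fun h a ha b hb => (key ⟨a, ha⟩ ⟨b, hb⟩).1 (h _ _),
      fun h a b => (key a b).2 (h _ a.2 _ b.2)⟩
  rw [hconn, and_assoc]
  refine and_congr_right fun hne => and_congr_right fun hs => ?_
  have hpre : (G.induce s).Preconnected := (hconn.2 ⟨hne, hs⟩).preconnected
  constructor
  · intro h v hv a ha b hb hav hbv
    have h1 := h ⟨v, hv⟩
    rw [IsCutpoint, isCutset_iff] at h1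
    push Not at h1
    obtain ⟨w, rfl, h2⟩ := h1
    have h3 := reachable_avoid_of_reachable_diff (G := G.induce s) (T := {⟨v, hv⟩})
      (v := ⟨v, hv⟩) (a := ⟨a, ha⟩) (b := ⟨b, hb⟩) h2 (by simpa using hav) (by simpa using hbv)
      (by rw [sdiff_self, Set.bot_eq_empty, avoid_empty]; exact hpre _ _)
    simpa using reachable_avoid_induce_iff.1 h3
  · rintro h ⟨v, hv⟩ hcut
    obtain ⟨a, b, -, -, ha, hb, hab⟩ := isCutset_iff.1 hcut ⟨v, hv⟩ rfl
    refine hab (reachable_avoid_induce_iff.2 ?_)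
    have := h v hv a a.2 b b.2 (fun h => ha (Subtype.ext h)) (fun h => hb (Subtype.ext h))
    simpa using this

theorem reachable_avoid_of_support {a b : V} (p : G.Walk a b) {T : Set V}
    (h : ∀ x ∈ p.support, x ∉ T) : (avoid G T).Reachable a b := by
  induction p with
  | nil => exact .rfl
  | cons hab p ih =>
    have h1 := h _ (SimpleGraph.Walk.start_mem_support _)
    have h2 : ∀ x ∈ p.support, x ∉ T := fun x hx => h x (by simp [hx])
    exact (SimpleGraph.Adj.reachable
      (⟨hab, h1, h2 _ p.start_mem_support⟩ : (avoid G T).Adj _ _)).trans (ih h2)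

variable {B : Set V}

/-- A path between two vertices of a block stays in the block: adding it to the block creates no
cutpoint, since after removing a vertex `x`, each of its other vertices is still joined along the
path to an end other than `x`. -/
theorem IsBlock.support_subset [Finite V] (hB : IsBlock G B) {w w' : V} (hw : w ∈ B) (hw' : w' ∈ B)
    (p : G.Walk w w') (hp : p.IsPath) : ∀ x ∈ p.support, x ∈ B := by
  classical
  obtain ⟨hne, hconn, hcut⟩ := connected_and_forall_not_isCutpoint_iff.1 hB.1
  let s : Set V := B ∪ {x | x ∈ p.support}
  have hBs : B ⊆ s := Set.subset_union_left
  -- every vertex of `s` other than `x` is joined to a vertex of the block other than `x`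
  have key : ∀ x, ∀ y ∈ s, y ≠ x → ∃ z ∈ B, z ≠ x ∧ (avoid G (sᶜ ∪ {x})).Reachable z y := by
    rintro x y (hy | hy) hyx
    · exact ⟨y, hy, hyx, .rfl⟩
    have hy : y ∈ p.support := hy
    have hstart : x ∉ (p.takeUntil y hy).support →
        ∃ z ∈ B, z ≠ x ∧ (avoid G (sᶜ ∪ {x})).Reachable z y := by
      intro hx
      refine ⟨w, hw, ?_, reachable_avoid_of_support (p.takeUntil y hy) ?_⟩
      · rintro rfl; exact hx (SimpleGraph.Walk.start_mem_support _)
      · rintro v hv (hvs | hvx)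
        · exact hvs (Or.inr (p.support_takeUntil_subset_support hy hv))
        · obtain rfl : v = x := hvx
          exact hx hv
    by_cases hx : x ∈ (p.takeUntil y hy).support
    · have hx' : x ∉ (p.dropUntil y hy).support := by
        intro hx2
        have hnd := hp.support_nodup
        rw [← p.take_spec hy, SimpleGraph.Walk.support_append] at hnd
        refine (List.nodup_append'.1 hnd).2.2 hx ?_
        rw [← SimpleGraph.Walk.cons_tail_support] at hx2
        exact (List.mem_cons.1 hx2).resolve_left (Ne.symm hyx)
      refine ⟨w', hw', ?_, (reachable_avoid_of_support (p.dropUntil y hy) ?_).symm⟩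
      · rintro rfl; exact hx' (SimpleGraph.Walk.end_mem_support _)
      · rintro v hv (hvs | hvx)
        · exact hvs (Or.inr (p.support_dropUntil_subset_support hy hv))
        · obtain rfl : v = x := hvx
          exact hx' hv
    · exact hstart hx
  have hs : (G.induce s).Connected ∧ ∀ v : s, ¬ IsCutpoint (G.induce s) v := by
    rw [connected_and_forall_not_isCutpoint_iff]
    refine ⟨hne.mono hBs, ?_, ?_⟩
    · have hmono : avoid G Bᶜ ≤ avoid G sᶜ := avoid_anti G (Set.compl_subset_compl.2 hBs)
      have h1 : ∀ y ∈ s, (avoid G sᶜ).Reachable w y := by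
        rintro y (hy | hy)
        · exact (hconn w hw y hy).mono hmono
        · refine reachable_avoid_of_support (p.takeUntil y hy) fun v hv hvs => ?_
          exact hvs (Or.inr (p.support_takeUntil_subset_support hy hv))
      exact fun a ha b hb => (h1 a ha).symm.trans (h1 b hb)
    · intro x _ a ha b hb hax hbx
      obtain ⟨z, hz, hzx, hza⟩ := key x a ha hax
      obtain ⟨z', hz', hzx', hzb⟩ := key x b hb hbx
      refine hza.symm.trans (SimpleGraph.Reachable.trans ?_ hzb)
      by_cases hxB : x ∈ B
      · exact (hcut x hxB z hz z' hz' hzx hzx').mono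
          (avoid_anti G (Set.union_subset_union_left _ (Set.compl_subset_compl.2 hBs)))
      · refine (hconn z hz z' hz').mono (avoid_anti G (Set.union_subset
          (Set.compl_subset_compl.2 hBs) ?_))
        rintro _ rfl
        exact hxB
  exact fun x hx => hB.2 hs hBs (Or.inr hx)

/-- The graph on all vertices whose edges are the edges of `G` that do not lie inside `B`. -/
def outer (G : SimpleGraph V) (B : Set V) : SimpleGraph V where
  Adj a b := G.Adj a b ∧ (a ∉ B ∨ b ∉ B)
  symm := ⟨fun _ _ h => ⟨h.1.symm, h.2.symm⟩⟩
  loopless := ⟨fun _ h => h.1.ne rfl⟩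

theorem outer_le (G : SimpleGraph V) (B : Set V) : outer G B ≤ G := fun _ _ h => h.1

/-- Distinct vertices of a block are not joined outside the block. -/
theorem IsBlock.eq_of_reachable_outer [Finite V] (hB : IsBlock G B) {w w' : V} (hw : w ∈ B)
    (hw' : w' ∈ B) (h : (outer G B).Reachable w w') : w = w' := by
  obtain ⟨p, hp⟩ := h.exists_isPath
  cases p with
  | nil => rfl
  | cons hab p =>
    have hsub := hB.support_subset hw hw' _
      (SimpleGraph.Walk.IsPath.mapLe (outer_le G B) hp)
    exact (hab.2.elim (fun h => h hw) fun h => h (hsub _ (by simp))).elim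

theorem IsBlock.mem_branch_iff [Finite V] (hB : IsBlock G B) {w v : V} (hw : w ∈ B) :
    v ∈ branch G B w ↔ (outer G B).Reachable w v := by
  classical
  constructor
  · rintro ⟨p, hp⟩
    suffices h : ∀ {a b : V} (p : G.Walk a b), (∀ x ∈ p.support, x ∈ B → x = w) →
        (outer G B).Reachable a b from h p hp
    intro a b p
    induction p with
    | nil => exact fun _ => .rfl
    | @cons a b _ hab p ih =>
      intro h
      refine (SimpleGraph.Adj.reachable (G := outer G B) (v := b) ⟨hab, ?_⟩).trans
        (ih fun x hx => h x (by simp [hx]))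
      by_contra! hno
      exact hab.ne ((h a (by simp) hno.1).trans (h b (by simp) hno.2).symm)
  · rintro ⟨p⟩
    refine ⟨p.mapLe (outer_le G B), fun x hx hxB => ?_⟩
    replace hx : x ∈ p.support := by simpa using hx
    exact (hB.eq_of_reachable_outer hw hxB (p.takeUntil x hx).reachable).symm

theorem IsBlock.nonempty [Finite V] (hB : IsBlock G B) : B.Nonempty :=
  (connected_and_forall_not_isCutpoint_iff.1 hB.1).1

/-- In a connected graph, every vertex is joined to the block outside the block. -/
theorem IsBlock.exists_reachable_outer [Finite V] (hB : IsBlock G B) (hG : G.Connected) (v : V) :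
    ∃ w ∈ B, (outer G B).Reachable w v := by
  obtain ⟨b, hb⟩ := hB.nonempty
  refine reachable_induction (H := G) (P := fun v => ∃ w ∈ B, (outer G B).Reachable w v)
    ⟨b, hb, .rfl⟩ ?_ (hG.preconnected b v)
  rintro x y ⟨w, hw, hwx⟩ hxy
  by_cases hy : y ∈ B
  · exact ⟨y, hy, .rfl⟩
  · exact ⟨w, hw, hwx.trans (SimpleGraph.Adj.reachable ⟨hxy, Or.inr hy⟩)⟩

/-- Walks that avoid `w` do not leave the part of the graph that hangs at `w`. -/
theorem IsBlock.reachable_avoid_of_reachable_avoid_singleton [Finite V] (hB : IsBlock G B)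
    {w a b : V} (hw : w ∈ B) (ha : a ∉ B) (hwa : (outer G B).Reachable w a)
    (h : (avoid G {w}).Reachable a b) :
    b ∉ B ∧ (outer G B).Reachable w b ∧ (avoid G B).Reachable a b := by
  refine reachable_induction (H := avoid G {w}) (P := fun b => b ∉ B ∧ (outer G B).Reachable w b ∧
    (avoid G B).Reachable a b) ⟨ha, hwa, .rfl⟩ ?_ h
  rintro x y ⟨hx, hwx, hax⟩ hxy
  have hwy : (outer G B).Reachable w y := hwx.trans (SimpleGraph.Adj.reachable ⟨hxy.1, Or.inl hx⟩)
  have hy : y ∉ B := fun hyB => hxy.2.2 (hB.eq_of_reachable_outer hw hyB hwy).symm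
  exact ⟨hy, hwy, hax.trans (SimpleGraph.Adj.reachable ⟨hxy.1, hx, hy⟩)⟩

/-- If an edge leaves a block at `w`, then `w` also has a neighbour in the block: otherwise the
block is `{w}`, which is not maximal because an edge is connected without cutpoints. -/
theorem IsBlock.exists_adj_mem [Finite V] (hB : IsBlock G B) {w a : V} (hw : w ∈ B)
    (hwa : G.Adj w a) (ha : a ∉ B) : ∃ b ∈ B, G.Adj w b := by
  by_cases h : ∃ b ∈ B, b ≠ w
  · obtain ⟨b, hb, hbw⟩ := h
    have h1 := (connected_and_forall_not_isCutpoint_iff.1 hB.1).2.1 w hw b hb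
    obtain ⟨c, hc⟩ := h1.nonempty_neighborSet_left hbw.symm
    exact ⟨c, not_not.1 hc.2.2, hc.1⟩
  · push Not at h
    refine absurd (hB.2 (y := {w, a}) ?_ (fun b hb => Or.inl (h b hb)) (Or.inr rfl)) ha
    beta_reduce
    rw [connected_and_forall_not_isCutpoint_iff]
    have hadj : (avoid G {w, a}ᶜ).Reachable w a :=
      SimpleGraph.Adj.reachable ⟨hwa, by simp, by simp⟩
    refine ⟨⟨w, Or.inl rfl⟩, ?_, ?_⟩
    · rintro x (rfl | rfl) y (rfl | rfl)
      exacts [.rfl, hadj, hadj.symm, .rfl]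
    · rintro v (rfl | rfl) x (rfl | rfl) y (rfl | rfl) hx hy <;> first | exact .rfl | contradiction

/-- A vertex of a block at which something hangs is a cutpoint: it separates that part of the graph
from its neighbours in the block. -/
theorem IsBlock.isCutpoint [Finite V] (hB : IsBlock G B) {w v : V} (hw : w ∈ B)
    (hv : v ∉ B) (h : (outer G B).Reachable w v) : IsCutpoint G w := by
  obtain ⟨a, ha⟩ := h.nonempty_neighborSet_left (by rintro rfl; exact hv hw)
  have haB : a ∉ B := ha.2.resolve_left fun h => h hw
  obtain ⟨b, hb, hwb⟩ := hB.exists_adj_mem hw ha.1 haB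
  rw [IsCutpoint, isCutset_iff]
  rintro _ rfl
  exact ⟨a, b, ha.1, hwb, ha.1.ne', hwb.ne', fun hab =>
    (hB.reachable_avoid_of_reachable_avoid_singleton hw haB ha.reachable hab).1 hb⟩

/-- A cutpoint of the graph in a block has a neighbour outside the block. -/
theorem IsBlock.exists_adj_notMem [Finite V] (hB : IsBlock G B) {w : V} (hw : w ∈ B)
    (h : IsCutpoint G w) : ∃ a, G.Adj w a ∧ a ∉ B := by
  obtain ⟨a, b, ha, hb, haw, hbw, hab⟩ := isCutset_iff.1 h w rfl
  by_contra! hno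
  refine hab (((connected_and_forall_not_isCutpoint_iff.1 hB.1).2.2 w hw a (hno a ha) b (hno b hb)
    haw hbw).mono (avoid_anti G Set.subset_union_right))

/-- If removing `w` leaves only two components, the part of the graph hanging at `w` is connected
without `w`. -/
theorem IsBlock.reachable_avoid [Finite V] (hB : IsBlock G B) {w a b : V} (hw : w ∈ B)
    (hc : numComponents G {w} = 2) (ha : a ∉ B) (hb : b ∉ B) (hwa : (outer G B).Reachable w a)
    (hwb : (outer G B).Reachable w b) : (avoid G B).Reachable a b := by
  obtain ⟨x, hx⟩ := hwa.nonempty_neighborSet_left (by rintro rfl; exact ha hw)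
  obtain ⟨y, hy, hwy⟩ := hB.exists_adj_mem hw hx.1 (hx.2.resolve_left fun h => h hw)
  refine (hB.reachable_avoid_of_reachable_avoid_singleton hw ha hwa ?_).2.2
  by_contra hab
  -- otherwise `w`, `a`, `b` and the neighbour `y` of `w` in the block are in four components
  let m := (avoid G {w}).connectedComponentMk
  have hcard : Nat.card (avoid G {w}).ConnectedComponent = 3 := by
    rw [card_component_avoid, hc, Set.ncard_singleton]
  have h1 : m a ≠ m b := fun h => hab (SimpleGraph.ConnectedComponent.exact h)
  have h2 : m a ≠ m y := fun h => (hB.reachable_avoid_of_reachable_avoid_singleton hw ha hwa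
    (SimpleGraph.ConnectedComponent.exact h)).1 hy
  have h3 : m b ≠ m y := fun h => (hB.reachable_avoid_of_reachable_avoid_singleton hw hb hwb
    (SimpleGraph.ConnectedComponent.exact h)).1 hy
  have h4 : ∀ z, z ≠ w → m w ≠ m z := fun z hz h =>
    hz (eq_of_reachable_avoid (Set.mem_singleton w) (SimpleGraph.ConnectedComponent.exact h)).symm
  have h5 : ({m w, m a, m b, m y} : Set _).ncard = 4 := by
    rw [Set.ncard_insert_of_notMem, Set.ncard_insert_of_notMem, Set.ncard_pair h3]
    · simp [h1, h2]
    · simp only [Set.mem_insert_iff, Set.mem_singleton_iff, not_or]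
      exact ⟨h4 a (by rintro rfl; exact ha hw), h4 b (by rintro rfl; exact hb hw), h4 y hwy.ne'⟩
  have h6 := Set.ncard_le_card ({m w, m a, m b, m y} : Set _)
  omega

end Block

/-! ### The projection onto the block with whiskers -/

section Whisker

variable {V : Type u} {G : SimpleGraph V} {B : Set V}

/-- The canonical projection exists: a vertex `v` outside the block is sent to the whisker at the
unique vertex `r v` of the block that is joined to `v` outside the block. -/
theorem IsBlock.exists_isWhiskerProjection [Finite V] (hB : IsBlock G B) (hG : G.Connected) :
    ∃ π : V → WhiskerVertex G B, IsWhiskerProjection G B π := by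
  classical
  choose r hrB hr using hB.exists_reachable_outer hG
  have huniq : ∀ {w v}, w ∈ B → (outer G B).Reachable w v → r v = w := fun hw h =>
    hB.eq_of_reachable_outer (hrB _) hw ((hr _).trans h.symm)
  let π : V → WhiskerVertex G B := fun v =>
    if hv : v ∈ B then Sum.inl ⟨v, hv⟩
    else Sum.inr ⟨r v, hrB v, hB.isCutpoint (hrB v) hv (hr v)⟩
  have hπ1 : ∀ v (hv : v ∈ B), π v = Sum.inl ⟨v, hv⟩ := fun v hv => dif_pos hv
  have hπ2 : ∀ v (hv : v ∉ B), π v = Sum.inr ⟨r v, hrB v, hB.isCutpoint (hrB v) hv (hr v)⟩ :=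
    fun v hv => dif_neg hv
  refine ⟨π, ?_, ?_, ?_⟩
  · rintro (b | ⟨w, hw, hwc⟩)
    · exact ⟨b, hπ1 b b.2⟩
    · obtain ⟨a, hwa, ha⟩ := hB.exists_adj_notMem hw hwc
      refine ⟨a, ?_⟩
      rw [hπ2 a ha]
      have : r a = w := huniq hw (SimpleGraph.Adj.reachable ⟨hwa, Or.inr ha⟩)
      simp [this]
  · intro v b
    by_cases hv : v ∈ B
    · rw [hπ1 v hv, Sum.inl.injEq, Subtype.ext_iff]
    · rw [hπ2 v hv]
      simp only [reduceCtorEq, false_iff]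
      rintro rfl
      exact hv b.2
  · rintro v ⟨w, hw, hwc⟩
    rw [Set.mem_sdiff, hB.mem_branch_iff hw, Set.mem_singleton_iff]
    by_cases hv : v ∈ B
    · rw [hπ1 v hv]
      simp only [reduceCtorEq, false_iff, not_and, not_not]
      exact fun h => (hB.eq_of_reachable_outer hw hv h).symm
    · rw [hπ2 v hv, Sum.inr.injEq, Subtype.ext_iff]
      constructor
      · rintro rfl
        exact ⟨hr v, fun h => hv (h ▸ hw)⟩
      · exact fun h => huniq hw h.1

/-- The set of vertices of the block with whiskers that corresponds to a set of vertices of the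
block. -/
def liftSet (G : SimpleGraph V) (B T : Set V) : Set (WhiskerVertex G B) :=
  {y | ∃ b : B, (b : V) ∈ T ∧ y = Sum.inl b}

theorem inl_mem_liftSet {T : Set V} {b : B} :
    (Sum.inl b : WhiskerVertex G B) ∈ liftSet G B T ↔ (b : V) ∈ T := by
  constructor
  · rintro ⟨b', hb', h⟩
    rwa [Sum.inl.inj h]
  · exact fun h => ⟨b, h, rfl⟩

theorem inr_notMem_liftSet {T : Set V} {w : cutpointsIn G B} :
    (Sum.inr w : WhiskerVertex G B) ∉ liftSet G B T := by
  rintro ⟨b, -, h⟩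
  cases h

theorem liftSet_diff_singleton {T : Set V} (b : B) :
    liftSet G B T \ {Sum.inl b} = liftSet G B (T \ {(b : V)}) := by
  ext (a | w)
  · simp [inl_mem_liftSet, Subtype.ext_iff]
  · simp [inr_notMem_liftSet]

theorem ncard_liftSet {T : Set V} (hT : T ⊆ B) : (liftSet G B T).ncard = T.ncard := by
  have h : Sum.inl '' (Subtype.val ⁻¹' T : Set B) = liftSet G B T := by
    ext y
    exact ⟨fun ⟨b, hb, h⟩ => ⟨b, hb, h.symm⟩, fun ⟨b, hb, h⟩ => ⟨b, hb, h.symm⟩⟩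
  rw [← h, Set.ncard_image_of_injective _ Sum.inl_injective,
    ← Set.ncard_image_of_injective _ Subtype.val_injective, Subtype.image_preimage_val,
    Set.inter_eq_right.2 hT]

/-- A whisker has only one neighbour, so the cutsets of the block with whiskers are sets of vertices
of the block. -/
theorem exists_eq_liftSet_of_isCutset [Finite V] {S : Set (WhiskerVertex G B)}
    (hS : IsCutset (blockWithWhiskers G B) S) : ∃ T ⊆ B, S = liftSet G B T := by
  have hinr : ∀ w, (Sum.inr w : WhiskerVertex G B) ∉ S := by
    intro w hw
    obtain ⟨a, b, ha, hb, -, -, hab⟩ := isCutset_iff.1 hS _ hw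
    rcases a with a | a
    · rcases b with b | b
      · have : a = b := Subtype.ext
          ((show (a : V) = w from ha).trans (show (b : V) = w from hb).symm)
        exact hab (this ▸ .rfl)
      · exact (show False from hb)
    · exact (show False from ha)
  refine ⟨Subtype.val '' (Sum.inl ⁻¹' S), by rintro _ ⟨b, -, rfl⟩; exact b.2, ?_⟩
  ext (b | w)
  · simp [inl_mem_liftSet]
  · simp [inr_notMem_liftSet, hinr]

namespace IsWhiskerProjection

variable {π : V → WhiskerVertex G B}

theorem apply_mem (hπ : IsWhiskerProjection G B π) {v : V} (hv : v ∈ B) :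
    π v = Sum.inl ⟨v, hv⟩ := (hπ.2.1 v ⟨v, hv⟩).2 rfl

theorem apply_eq_inr_iff [Finite V] (hπ : IsWhiskerProjection G B π) (hB : IsBlock G B) {v : V}
    {w : cutpointsIn G B} : π v = Sum.inr w ↔ v ∉ B ∧ (outer G B).Reachable w v := by
  rw [hπ.2.2, Set.mem_sdiff, hB.mem_branch_iff w.2.1, Set.mem_singleton_iff, and_comm]
  refine and_congr_left fun h => not_congr ⟨?_, ?_⟩
  · rintro rfl; exact w.2.1
  · exact fun hv => (hB.eq_of_reachable_outer w.2.1 hv h).symm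

theorem exists_apply_notMem (hπ : IsWhiskerProjection G B π) {v : V} (hv : v ∉ B) :
    ∃ w, π v = Sum.inr w := by
  rcases h : π v with b | w
  · exact absurd ((hπ.2.1 v b).1 h ▸ b.2) hv
  · exact ⟨w, rfl⟩

theorem apply_mem_liftSet_iff (hπ : IsWhiskerProjection G B π) {T : Set V} (hT : T ⊆ B) {v : V} :
    π v ∈ liftSet G B T ↔ v ∈ T := by
  constructor
  · rintro ⟨b, hb, h⟩
    rwa [(hπ.2.1 v b).1 h]
  · exact fun hv => ⟨⟨v, hT hv⟩, hv, hπ.apply_mem (hT hv)⟩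

/-- The projection sends an edge to an edge or to a single vertex. -/
theorem apply_eq_or_adj [Finite V] (hπ : IsWhiskerProjection G B π) (hB : IsBlock G B) {a b : V}
    (h : G.Adj a b) : π a = π b ∨ (blockWithWhiskers G B).Adj (π a) (π b) := by
  have key : ∀ {a b}, G.Adj a b → a ∈ B → b ∉ B → (blockWithWhiskers G B).Adj (π a) (π b) := by
    intro a b h ha hb
    obtain ⟨w, hw⟩ := hπ.exists_apply_notMem hb
    have h1 := ((hπ.apply_eq_inr_iff hB).1 hw).2
    rw [hw, hπ.apply_mem ha]
    have h2 : (outer G B).Reachable a b := SimpleGraph.Adj.reachable ⟨h, Or.inr hb⟩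
    exact hB.eq_of_reachable_outer ha w.2.1 (h2.trans h1.symm)
  by_cases ha : a ∈ B <;> by_cases hb : b ∈ B
  · right
    rw [hπ.apply_mem ha, hπ.apply_mem hb]
    exact h
  · exact Or.inr (key h ha hb)
  · exact Or.inr (key h.symm hb ha).symm
  · left
    obtain ⟨w, hw⟩ := hπ.exists_apply_notMem ha
    have h1 := ((hπ.apply_eq_inr_iff hB).1 hw).2
    rw [hw, eq_comm, hπ.apply_eq_inr_iff hB]
    exact ⟨hb, h1.trans (SimpleGraph.Adj.reachable ⟨h, Or.inl ha⟩)⟩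

/-- The projection preserves and reflects connectedness after the removal of a set of vertices of
the block, because its fibres are connected. -/
theorem reachable_iff [Finite V] (hπ : IsWhiskerProjection G B π) (hB : IsBlock G B)
    (hW : ∀ w ∈ cutpointsIn G B, numComponents G {w} = 2) {T : Set V} (hT : T ⊆ B) {a b : V}
    (hb : b ∉ T) :
    (avoid (blockWithWhiskers G B) (liftSet G B T)).Reachable (π a) (π b) ↔
      (avoid G T).Reachable a b := by
  have hfib : ∀ {x y : V} {w}, π x = Sum.inr w → π y = Sum.inr w → (avoid G T).Reachable x y := by
    intro x y w hx hy
    rw [hπ.apply_eq_inr_iff hB] at hx hy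
    exact (hB.reachable_avoid w.2.1 (hW _ w.2) hx.1 hy.1 hx.2 hy.2).mono (avoid_anti G hT)
  have hbranch : ∀ {y : V} {w : cutpointsIn G B}, (w : V) ∉ T → π y = Sum.inr w →
      (avoid G T).Reachable w y := by
    intro y w hw hy
    refine (reachable_induction (H := outer G B)
      (P := fun z => (outer G B).Reachable w z ∧ z ∉ T ∧ (avoid G T).Reachable w z)
      ⟨.rfl, hw, .rfl⟩ ?_ ((hπ.apply_eq_inr_iff hB).1 hy).2).2.2
    rintro c d ⟨h1, h2, h3⟩ hcd
    have h4 := h1.trans hcd.reachable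
    have hd : d ∉ T := fun hd => hw (hB.eq_of_reachable_outer w.2.1 (hT hd) h4 ▸ hd)
    exact ⟨h4, hd, h3.trans (SimpleGraph.Adj.reachable ⟨hcd.1, h2, hd⟩)⟩
  constructor
  · intro h
    refine reachable_induction (H := avoid (blockWithWhiskers G B) (liftSet G B T))
      (P := fun y => ∀ b, b ∉ T → π b = y → (avoid G T).Reachable a b) ?_ ?_ h b hb rfl
    · intro c _ hca
      by_cases ha : a ∈ B
      · rw [hπ.apply_mem ha] at hca
        rw [(hπ.2.1 _ _).1 hca]
      · obtain ⟨w, hw⟩ := hπ.exists_apply_notMem ha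
        exact hfib hw (hca.trans hw)
    · rintro y z hy hyz c hc rfl
      obtain ⟨d, rfl⟩ := hπ.1 y
      have hd : d ∉ T := fun h => hyz.2.1 ((hπ.apply_mem_liftSet_iff hT).2 h)
      refine (hy d hd rfl).trans ?_
      have hadj := hyz.1
      by_cases hdB : d ∈ B
      · by_cases hcB : c ∈ B
        · rw [hπ.apply_mem hcB, hπ.apply_mem hdB] at hadj
          exact SimpleGraph.Adj.reachable ⟨hadj, hd, hc⟩
        · obtain ⟨w, hw⟩ := hπ.exists_apply_notMem hcB
          rw [hπ.apply_mem hdB, hw] at hadj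
          obtain rfl : d = w := hadj
          exact hbranch hd hw
      · obtain ⟨w, hw⟩ := hπ.exists_apply_notMem hdB
        by_cases hcB : c ∈ B
        · rw [hπ.apply_mem hcB, hw] at hadj
          obtain rfl : c = w := hadj
          exact (hbranch hc hw).symm
        · obtain ⟨w', hw'⟩ := hπ.exists_apply_notMem hcB
          rw [hw', hw] at hadj
          exact (show False from hadj).elim
  · intro h
    refine reachable_induction (H := avoid G T) (P := fun b =>
      (avoid (blockWithWhiskers G B) (liftSet G B T)).Reachable (π a) (π b)) .rfl ?_ h
    intro c d hc hcd
    rcases hπ.apply_eq_or_adj hB hcd.1 with h | h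
    · exact h ▸ hc
    · exact hc.trans (SimpleGraph.Adj.reachable ⟨h,
        (hπ.apply_mem_liftSet_iff hT).not.2 hcd.2.1, (hπ.apply_mem_liftSet_iff hT).not.2 hcd.2.2⟩)

/-- The projection induces a bijection between the components of `G ∖ T` and those of the block with
whiskers minus `T`. -/
theorem exists_equiv [Finite V] (hπ : IsWhiskerProjection G B π) (hB : IsBlock G B)
    (hW : ∀ w ∈ cutpointsIn G B, numComponents G {w} = 2) {T : Set V} (hT : T ⊆ B) :
    ∃ e : (G.induce Tᶜ).ConnectedComponent ≃
        ((blockWithWhiskers G B).induce (liftSet G B T)ᶜ).ConnectedComponent,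
      ∀ (v : V) (hv : v ∈ Tᶜ), ∃ hv' : π v ∈ (liftSet G B T)ᶜ,
        e ((G.induce Tᶜ).connectedComponentMk ⟨v, hv⟩) =
          ((blockWithWhiskers G B).induce (liftSet G B T)ᶜ).connectedComponentMk ⟨π v, hv'⟩ := by
  have hmem : ∀ {v}, v ∈ Tᶜ → π v ∈ (liftSet G B T)ᶜ :=
    fun hv => (hπ.apply_mem_liftSet_iff hT).not.2 hv
  have key : ∀ x y : (Tᶜ : Set V), ((blockWithWhiskers G B).induce (liftSet G B T)ᶜ).Reachable
      ⟨π x, hmem x.2⟩ ⟨π y, hmem y.2⟩ ↔ (G.induce Tᶜ).Reachable x y := fun x y => by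
    rw [reachable_induce_iff, hπ.reachable_iff hB hW hT y.2, ← reachable_induce_iff x.2 y.2]
  let f : (G.induce Tᶜ).ConnectedComponent →
      ((blockWithWhiskers G B).induce (liftSet G B T)ᶜ).ConnectedComponent :=
    Quot.map (fun x => ⟨π x, hmem x.2⟩) fun x y h => (key x y).2 h
  have hf : Function.Bijective f := by
    constructor
    · intro c d h
      induction c using SimpleGraph.ConnectedComponent.ind with | _ c =>
      induction d using SimpleGraph.ConnectedComponent.ind with | _ d =>
      exact SimpleGraph.ConnectedComponent.sound
        ((key c d).1 (SimpleGraph.ConnectedComponent.exact h))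
    · intro c
      induction c using SimpleGraph.ConnectedComponent.ind with | _ c =>
      obtain ⟨y, hy⟩ := c
      obtain ⟨v, rfl⟩ := hπ.1 y
      exact ⟨(G.induce Tᶜ).connectedComponentMk
        ⟨v, fun hv => hy ((hπ.apply_mem_liftSet_iff hT).2 hv)⟩, rfl⟩
  exact ⟨Equiv.ofBijective f hf, fun v hv => ⟨hmem hv, rfl⟩⟩

theorem numComponents_liftSet [Finite V] (hπ : IsWhiskerProjection G B π) (hB : IsBlock G B)
    (hW : ∀ w ∈ cutpointsIn G B, numComponents G {w} = 2) {T : Set V} (hT : T ⊆ B) :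
    numComponents (blockWithWhiskers G B) (liftSet G B T) = numComponents G T :=
  let ⟨e, _⟩ := hπ.exists_equiv hB hW hT
  (Nat.card_congr e).symm

theorem isCutset_liftSet_iff [Finite V] (hπ : IsWhiskerProjection G B π) (hB : IsBlock G B)
    (hW : ∀ w ∈ cutpointsIn G B, numComponents G {w} = 2) {T : Set V} (hT : T ⊆ B) :
    IsCutset (blockWithWhiskers G B) (liftSet G B T) ↔ IsCutset G T := by
  have key : ∀ b : B, numComponents (blockWithWhiskers G B) (liftSet G B T \ {Sum.inl b}) =
      numComponents G (T \ {(b : V)}) := fun b => by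
    rw [liftSet_diff_singleton, hπ.numComponents_liftSet hB hW (Set.sdiff_subset.trans hT)]
  constructor
  · intro h v hv
    have := h (Sum.inl ⟨v, hT hv⟩) (inl_mem_liftSet.2 hv)
    rwa [key, hπ.numComponents_liftSet hB hW hT] at this
  · rintro h _ ⟨b, hb, rfl⟩
    rw [key, hπ.numComponents_liftSet hB hW hT]
    exact h b hb

end IsWhiskerProjection

theorem connected_blockWithWhiskers [Finite V] (hB : IsBlock G B) (hG : G.Connected)
    (hW : ∀ w ∈ cutpointsIn G B, numComponents G {w} = 2) :
    (blockWithWhiskers G B).Connected := by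
  obtain ⟨π, hπ⟩ := hB.exists_isWhiskerProjection hG
  have := hG.nonempty.map π
  refine ⟨fun x y => ?_⟩
  obtain ⟨a, rfl⟩ := hπ.1 x
  obtain ⟨b, rfl⟩ := hπ.1 y
  have h := (hπ.reachable_iff hB hW (Set.empty_subset B) (Set.notMem_empty b) (a := a)).2
    (by rw [avoid_empty]; exact hG.preconnected a b)
  exact h.mono fun _ _ (h : (avoid _ _).Adj _ _) => h.1

end Whisker

end AccessibleGraph

theorem mainTheorem5 (K : Type*) [Field K] {V : Type*} [Finite V] (G : SimpleGraph V)
    (hconn : G.Connected) (hG : AccessibleGraph.IsAccessible K G)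
    (B : Set V) (hB : AccessibleGraph.IsBlock G B) :
    AccessibleGraph.IsAccessible K (AccessibleGraph.blockWithWhiskers G B) ∧
      ∃ π : V → AccessibleGraph.WhiskerVertex G B,
        AccessibleGraph.IsWhiskerProjection G B π ∧
        ∀ S : Set (AccessibleGraph.WhiskerVertex G B),
          AccessibleGraph.IsCutset (AccessibleGraph.blockWithWhiskers G B) S →
          ∃ T : Set V, T ⊆ B ∧ S = {y | ∃ b : B, (b : V) ∈ T ∧ y = Sum.inl b} ∧
            ∃ e : (G.induce Tᶜ).ConnectedComponent ≃
                ((AccessibleGraph.blockWithWhiskers G B).induce Sᶜ).ConnectedComponent,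
              ∀ (v : V) (hv : v ∈ Tᶜ), ∃ hπ : π v ∈ Sᶜ,
                e ((G.induce Tᶜ).connectedComponentMk ⟨v, hv⟩) =
                  ((AccessibleGraph.blockWithWhiskers G B).induce Sᶜ).connectedComponentMk
                    ⟨π v, hπ⟩ := by
  obtain ⟨hunm, hacc⟩ := hG
  have hcard := (AccessibleGraph.isUnmixed_iff hconn).1 hunm
  have hW : ∀ w ∈ AccessibleGraph.cutpointsIn G B, AccessibleGraph.numComponents G {w} = 2 := by
    intro w hw
    rw [hcard {w} hw.2, Set.ncard_singleton]
  obtain ⟨π, hπ⟩ := hB.exists_isWhiskerProjection hconn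
  refine ⟨⟨?_, ?_⟩, π, hπ, ?_⟩
  · rw [AccessibleGraph.isUnmixed_iff
      (AccessibleGraph.connected_blockWithWhiskers hB hconn hW)]
    intro S hS
    obtain ⟨T, hT, rfl⟩ := AccessibleGraph.exists_eq_liftSet_of_isCutset hS
    rw [hπ.numComponents_liftSet hB hW hT, AccessibleGraph.ncard_liftSet hT]
    exact hcard T ((hπ.isCutset_liftSet_iff hB hW hT).1 hS)
  · intro S hS hne
    obtain ⟨T, hT, rfl⟩ := AccessibleGraph.exists_eq_liftSet_of_isCutset hS
    obtain ⟨_, b, hb, rfl⟩ := hne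
    obtain ⟨t, ht, hcut⟩ := hacc T ((hπ.isCutset_liftSet_iff hB hW hT).1 hS) ⟨b, hb⟩
    refine ⟨Sum.inl ⟨t, hT ht⟩, AccessibleGraph.inl_mem_liftSet.2 ht, ?_⟩
    rw [AccessibleGraph.liftSet_diff_singleton]
    exact (hπ.isCutset_liftSet_iff hB hW (Set.sdiff_subset.trans hT)).2 hcut
  · intro S hS
    obtain ⟨T, hT, rfl⟩ := AccessibleGraph.exists_eq_liftSet_of_isCutset hS
    exact ⟨T, hT, rfl, hπ.exists_equiv hB hW hT⟩
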